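/- **Chain rule for subdifferentials in a mixed frame.** Let $\Omega\subset\mathbb R^N$ be an open set (e.g. a domain, possibly unbounded and nonsmooth), $0<T<\infty$, $Q:=\Omega\times(0,T)$, and let $p$ be a measurable exponent on $\Omega$ with $1<p^-:=\operatorname{ess\,inf}_\Omega p$ and $p^+:=\operatorname{ess\,sup}_\Omega p<\infty$; put $p'(x):=p(x)/(p(x)-1)$. Let $V:=L^{p(x)}(\Omega)$ and $\mathcal V:=L^{p(x)}(Q)$ be the spaces of (classes of) measurable functions with $\int|v|^{p(x)}<\infty$, with the Luxemburg norm $\inf\{\lambda>0:\int|v/\lambda|^{p(x)}\le 1\}$; their duals are identified with $V^*=L^{p'(x)}(\Omega)$ and $\mathcal V^*=L^{p'(x)}(Q)$ through $\langle\eta,v\rangle_V=\int_\Omega\eta v\,dx$ and $\langle\xi,v\rangle_{\mathcal V}=\iint_Q\xi v\,dx\,dt$. For $u\in\mathcal V$ let $Pu(t):=u(\cdot,t)\in V$ for a.e. $t\in(0,T)$. Let $\varphi:V\to(-\infty,\infty]$ be proper, lower semicontinuous and convex, and define $\Phi:\mathcal V\to(-\infty,\infty]$ by $\Phi(u)=\int_0^T\varphi(Pu(t))\,dt$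 if $\varphi(Pu(\cdot))\in L^1(0,T)$ and $\Phi(u)=\infty$ otherwise. For a functional $F$ on $V$ (respectively $\mathcal V$) and $w$ with $F(w)<\infty$, $\partial_\Omega F(w)$ (respectively $\partial_QF(w)$) is the set of all $\zeta$ in the dual space with $F(v)-F(w)\ge\langle\zeta,v-w\rangle$ for all $v$; it is empty if $F(w)=\infty$. Let $u\in\mathcal V$ have a weak time derivative $\partial_tu\in\mathcal V$, and let $\xi\in\mathcal V^*$ satisfy $\xi\in\partial_Q\Phi(u)$. Then $Pu$ has a representative that is absolutely continuous from $[0,T]$ to $V$ (again denoted by $Pu$), and for this representative: 1. $\varphi(Pu(t))<\infty$ for all $t\in[0,T]$, and $t\mapsto\varphi(Pu(t))$ is absolutely continuous on $[0,T]$; 2. for each $t\in(0,T)$ at which both $Pu$ and $\varphi(Pu(\cdot))$ are differentiable, $$\frac{d}{dt}\varphi(Pu(t))=\langle\eta,(Pu)'(t)\rangle_V\quad\text{for all }\eta\in\partial_\Omega\varphi(Pu(t));$$ 3. for all $0\le s<t\le T$, $$\varphi(Pu(t))-\varphi(Pu(s))=\iint_{\Omega\times(s,t)}\xi\,\partial_\tau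 u\,dx\,d\tau .$$ -/

import Mathlib

open MeasureTheory Set Filter Topology
open scoped ENNReal NNReal

namespace VarLebesgue

/-- A measurable variable exponent `p` with `1 < p⁻ ≤ p⁺ < ∞`, where `p⁻ = ess inf p` and
`p⁺ = ess sup p` with respect to `μ`. -/
structure Exponent {α : Type*} [MeasurableSpace α] (μ : Measure α) where
  toFun : α → ℝ≥0∞
  aemeasurable : AEMeasurable toFun μ
  one_lt_essInf : 1 < essInf toFun μ
  essSup_lt_top : essSup toFun μ < ∞

section Space

variable {α : Type*} [MeasurableSpace α] {μ : Measure α}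

theorem Exponent.ae_lt_top (p : Exponent μ) : ∀ᵐ x ∂μ, p.toFun x < ∞ := by
  filter_upwards [ENNReal.ae_le_essSup p.toFun] with x hx
  exact hx.trans_lt p.essSup_lt_top

theorem Exponent.ae_one_lt (p : Exponent μ) : ∀ᵐ x ∂μ, 1 < p.toFun x := by
  filter_upwards [ae_essInf_le (μ := μ) (f := p.toFun)] with x hx
  exact p.one_lt_essInf.trans_le hx

theorem Exponent.ae_one_le_toReal (p : Exponent μ) : ∀ᵐ x ∂μ, 1 ≤ (p.toFun x).toReal := by
  filter_upwards [p.ae_lt_top, p.ae_one_lt] with x h1 h2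
  have := (ENNReal.toReal_le_toReal ENNReal.one_ne_top h1.ne).2 h2.le
  simpa using this

/-- The conjugate exponent `p'`, with `1 / p + 1 / p' = 1` almost everywhere. -/
noncomputable def Exponent.conj (p : Exponent μ) : Exponent μ where
  toFun x := (p.toFun x).conjExponent
  aemeasurable := by
    unfold ENNReal.conjExponent
    exact ((p.aemeasurable.sub_const 1).inv).const_add 1
  one_lt_essInf := by
    have h : 1 + (essSup p.toFun μ - 1)⁻¹ ≤ essInf (fun x => (p.toFun x).conjExponent) μ := by
      refine le_essInf_of_ae_le _ ?_
      filter_upwards [ENNReal.ae_le_essSup p.toFun] with x hx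
      unfold ENNReal.conjExponent
      gcongr
    refine lt_of_lt_of_le ?_ h
    refine ENNReal.lt_add_right ENNReal.one_ne_top ?_
    rw [Ne, ENNReal.inv_eq_zero]
    exact ENNReal.sub_ne_top p.essSup_lt_top.ne
  essSup_lt_top := by
    have h : essSup (fun x => (p.toFun x).conjExponent) μ ≤ 1 + (essInf p.toFun μ - 1)⁻¹ := by
      refine essSup_le_of_ae_le _ ?_
      filter_upwards [ae_essInf_le (μ := μ) (f := p.toFun)] with x hx
      unfold ENNReal.conjExponent
      gcongr
    refine lt_of_le_of_lt h ?_
    refine ENNReal.add_lt_top.2 ⟨ENNReal.one_lt_top, ?_⟩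
    rw [ENNReal.inv_lt_top]
    exact tsub_pos_of_lt p.one_lt_essInf

/-- The modular `∫ |f(x)| ^ p(x) dμ(x)`, with values in `[0, ∞]`. -/
noncomputable def modular (p : Exponent μ) (f : α → ℝ) : ℝ≥0∞ :=
  ∫⁻ x, ‖f x‖ₑ ^ (p.toFun x).toReal ∂μ

theorem modular_congr (p : Exponent μ) {f g : α → ℝ} (h : f =ᵐ[μ] g) :
    modular p f = modular p g := by
  apply lintegral_congr_ae
  filter_upwards [h] with x hx
  rw [hx]

theorem aemeasurable_modular (p : Exponent μ) {f : α → ℝ} (hf : AEStronglyMeasurable f μ) :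
    AEMeasurable (fun x => ‖f x‖ₑ ^ (p.toFun x).toReal) μ :=
  hf.enorm.pow p.aemeasurable.ennreal_toReal

theorem modular_const_mul_le (p : Exponent μ) {f : α → ℝ} {c : ℝ} (h0 : 0 ≤ c) (h1 : c ≤ 1) :
    modular p (fun x => c * f x) ≤ ENNReal.ofReal c * modular p f := by
  unfold modular
  rw [← lintegral_const_mul' _ _ ENNReal.ofReal_ne_top]
  apply lintegral_mono_ae
  filter_upwards [p.ae_one_le_toReal] with x hx
  rw [enorm_mul, ENNReal.mul_rpow_of_nonneg _ _ (by linarith), Real.enorm_of_nonneg h0]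
  gcongr
  calc ENNReal.ofReal c ^ (p.toFun x).toReal ≤ ENNReal.ofReal c ^ (1 : ℝ) :=
        ENNReal.rpow_le_rpow_of_exponent_ge (by simpa using h1) hx
    _ = _ := ENNReal.rpow_one _

theorem modular_convex (p : Exponent μ) {f g : α → ℝ} (hf : AEStronglyMeasurable f μ)
    {a b : ℝ} (ha : 0 ≤ a) (hb : 0 ≤ b) (hab : a + b = 1) :
    modular p (fun x => a * f x + b * g x) ≤
      ENNReal.ofReal a * modular p f + ENNReal.ofReal b * modular p g := by
  unfold modular
  rw [← lintegral_const_mul' _ _ ENNReal.ofReal_ne_top,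
    ← lintegral_const_mul' _ _ ENNReal.ofReal_ne_top,
    ← lintegral_add_left' ((aemeasurable_modular p hf).const_mul _)]
  apply lintegral_mono_ae
  filter_upwards [p.ae_one_le_toReal] with x hx
  refine le_trans ?_ (ENNReal.rpow_arith_mean_le_arith_mean2_rpow _ _ _ _ ?_ hx)
  · refine ENNReal.rpow_le_rpow ?_ (by linarith)
    refine (enorm_add_le _ _).trans ?_
    rw [enorm_mul, enorm_mul, Real.enorm_of_nonneg ha, Real.enorm_of_nonneg hb]
  · rw [← ENNReal.ofReal_add ha hb, hab, ENNReal.ofReal_one]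

theorem modular_zero (p : Exponent μ) : modular p (fun _ => (0 : ℝ)) = 0 := by
  have := modular_const_mul_le p (f := fun _ => (0 : ℝ)) le_rfl zero_le_one
  simpa using this

theorem modular_abs (p : Exponent μ) (f : α → ℝ) (c : ℝ) :
    modular p (fun x => |c| * f x) = modular p (fun x => c * f x) := by
  unfold modular
  simp [enorm_mul, Real.enorm_abs]

theorem modular_const_mul_lt_top (p : Exponent μ) {f : α → ℝ} (hf : modular p f < ∞) (c : ℝ) :
    modular p (fun x => c * f x) < ∞ := by
  set M : ℝ := (essSup p.toFun μ).toReal with hM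
  have hM0 : 0 ≤ M := ENNReal.toReal_nonneg
  have hle : modular p (fun x => c * f x) ≤ (max 1 ‖c‖ₑ) ^ M * modular p f := by
    unfold modular
    rw [← lintegral_const_mul' _ _ (ENNReal.rpow_ne_top_of_nonneg hM0 (by simp))]
    apply lintegral_mono_ae
    filter_upwards [p.ae_one_le_toReal, ENNReal.ae_le_essSup p.toFun] with x h1 h2
    rw [enorm_mul, ENNReal.mul_rpow_of_nonneg _ _ (by linarith)]
    gcongr
    refine (ENNReal.rpow_le_rpow (le_max_right 1 ‖c‖ₑ) (by linarith)).trans ?_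
    exact ENNReal.rpow_le_rpow_of_exponent_le (le_max_left _ _)
      (ENNReal.toReal_mono p.essSup_lt_top.ne h2)
  refine hle.trans_lt (ENNReal.mul_lt_top ?_ hf)
  exact (ENNReal.rpow_ne_top_of_nonneg hM0 (by simp)).lt_top

/-- The variable exponent Lebesgue space as a subspace of the space of classes of a.e. equal
measurable functions: those `f` with `∫ |f| ^ p(x) dμ < ∞`. -/
def lpVarSubmodule (p : Exponent μ) : Submodule ℝ (α →ₘ[μ] ℝ) where
  carrier := {f | modular p f < ∞}
  zero_mem' := by
    change modular p ((0 : α →ₘ[μ] ℝ) : α → ℝ) < ∞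
    rw [modular_congr p (g := fun _ => (0 : ℝ)) AEEqFun.coeFn_zero, modular_zero]
    exact ENNReal.zero_lt_top
  add_mem' := by
    intro f g hf hg
    change modular p ((f + g : α →ₘ[μ] ℝ) : α → ℝ) < ∞
    have h : ((f + g : α →ₘ[μ] ℝ) : α → ℝ) =ᵐ[μ]
        fun x => (1 / 2 : ℝ) * (2 * f x) + (1 / 2 : ℝ) * (2 * g x) := by
      filter_upwards [AEEqFun.coeFn_add f g] with x hx
      rw [hx]
      simp
    rw [modular_congr p h]
    refine (modular_convex p (f := fun x => 2 * f x) (g := fun x => 2 * g x)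
      (f.aestronglyMeasurable.const_mul 2) (by norm_num) (by norm_num) (by norm_num)).trans_lt ?_
    exact ENNReal.add_lt_top.2
      ⟨ENNReal.mul_lt_top ENNReal.ofReal_lt_top (modular_const_mul_lt_top p hf 2),
        ENNReal.mul_lt_top ENNReal.ofReal_lt_top (modular_const_mul_lt_top p hg 2)⟩
  smul_mem' := by
    intro c f hf
    change modular p ((c • f : α →ₘ[μ] ℝ) : α → ℝ) < ∞
    have h : ((c • f : α →ₘ[μ] ℝ) : α → ℝ) =ᵐ[μ] fun x => c * f x := by
      filter_upwards [AEEqFun.coeFn_smul c f] with x hx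
      rw [hx]
      simp
    rw [modular_congr p h]
    exact modular_const_mul_lt_top p hf c

/-- The variable exponent Lebesgue space `L^{p(x)}(μ)` of real functions. -/
def LpVar (p : Exponent μ) : Type _ := lpVarSubmodule p

namespace LpVar

variable {p : Exponent μ}

instance instAddCommGroup : AddCommGroup (LpVar p) :=
  inferInstanceAs (AddCommGroup (lpVarSubmodule p))

instance instModule : Module ℝ (LpVar p) :=
  inferInstanceAs (Module ℝ (lpVarSubmodule p))

/-- The underlying class of a.e. equal measurable functions. -/
def toAEEqFun (f : LpVar p) : α →ₘ[μ] ℝ := (lpVarSubmodule p).subtype f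

noncomputable instance instCoeFun : CoeFun (LpVar p) (fun _ => α → ℝ) :=
  ⟨fun f => (f.toAEEqFun : α → ℝ)⟩

theorem aestronglyMeasurable (f : LpVar p) : AEStronglyMeasurable (f : α → ℝ) μ :=
  AEEqFun.aestronglyMeasurable _

theorem modular_lt_top (f : LpVar p) : modular p f < ∞ := f.2

/-- The class of a measurable function with finite modular. -/
noncomputable def mk (f : α → ℝ) (hf : AEStronglyMeasurable f μ) (h : modular p f < ∞) :
    LpVar p :=
  ⟨AEEqFun.mk f hf, by
    change modular p (AEEqFun.mk f hf) < ∞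
    rwa [modular_congr p (AEEqFun.coeFn_mk f hf)]⟩

theorem coeFn_mk (f : α → ℝ) (hf : AEStronglyMeasurable f μ) (h : modular p f < ∞) :
    (mk f hf h : α → ℝ) =ᵐ[μ] f :=
  AEEqFun.coeFn_mk f hf

theorem coeFn_add (f g : LpVar p) : ((f + g : LpVar p) : α → ℝ) =ᵐ[μ] fun x => f x + g x :=
  AEEqFun.coeFn_add f.toAEEqFun g.toAEEqFun

theorem coeFn_smul (c : ℝ) (f : LpVar p) :
    ((c • f : LpVar p) : α → ℝ) =ᵐ[μ] fun x => c * f x :=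
  AEEqFun.coeFn_smul c f.toAEEqFun

theorem coeFn_zero : ((0 : LpVar p) : α → ℝ) =ᵐ[μ] fun _ => 0 :=
  AEEqFun.coeFn_zero

theorem ext {f g : LpVar p} (h : (f : α → ℝ) =ᵐ[μ] g) : f = g :=
  Subtype.ext (AEEqFun.ext h)

/-- The admissible scalings in the Luxemburg norm. -/
def normSet (f : LpVar p) : Set ℝ :=
  {r | 0 < r ∧ modular p (fun x => f x / r) ≤ 1}

/-- The Luxemburg norm `inf {r > 0 : ∫ |f(x) / r| ^ p(x) dμ ≤ 1}`. -/
noncomputable instance instNorm : Norm (LpVar p) := ⟨fun f => sInf (normSet f)⟩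

theorem norm_def (f : LpVar p) : ‖f‖ = sInf (normSet f) := rfl

theorem normSet_bddBelow (f : LpVar p) : BddBelow (normSet f) := ⟨0, fun _ hr => hr.1.le⟩

theorem normSet_nonempty (f : LpVar p) : (normSet f).Nonempty := by
  set r : ℝ := max 1 (modular p f).toReal with hr
  have hr1 : 1 ≤ r := le_max_left _ _
  have hr0 : 0 < r := by linarith
  refine ⟨r, hr0, ?_⟩
  have h : modular p (fun x => f x / r) ≤ ENNReal.ofReal r⁻¹ * modular p f := by
    simp_rw [div_eq_inv_mul]
    exact modular_const_mul_le p (by positivity) (inv_le_one_of_one_le₀ hr1)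
  refine h.trans ?_
  rw [← ENNReal.ofReal_toReal (modular_lt_top f).ne, ← ENNReal.ofReal_mul (by positivity)]
  rw [ENNReal.ofReal_le_one, inv_mul_le_iff₀ hr0, mul_one]
  exact le_max_right _ _

theorem norm_nonneg' (f : LpVar p) : 0 ≤ ‖f‖ := Real.sInf_nonneg fun _ hr => hr.1.le

theorem norm_le_of_mem {f : LpVar p} {r : ℝ} (hr : r ∈ normSet f) : ‖f‖ ≤ r :=
  csInf_le (normSet_bddBelow f) hr

theorem norm_zero' : ‖(0 : LpVar p)‖ = 0 := by
  refine le_antisymm (le_of_forall_pos_le_add fun ε hε => ?_) (norm_nonneg' _)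
  rw [zero_add]
  refine norm_le_of_mem ⟨hε, ?_⟩
  have h : (fun x => (0 : LpVar p) x / ε) =ᵐ[μ] fun _ => 0 := by
    filter_upwards [coeFn_zero (p := p)] with x hx
    rw [hx, zero_div]
  rw [modular_congr p h, modular_zero]
  exact zero_le_one

theorem norm_add_le' (f g : LpVar p) : ‖f + g‖ ≤ ‖f‖ + ‖g‖ := by
  refine le_of_forall_pos_le_add fun ε hε => ?_
  obtain ⟨r, hr, hrε⟩ := exists_lt_of_csInf_lt (normSet_nonempty f)
    (show sInf (normSet f) < ‖f‖ + ε / 2 by rw [← norm_def]; linarith)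
  obtain ⟨s, hs, hsε⟩ := exists_lt_of_csInf_lt (normSet_nonempty g)
    (show sInf (normSet g) < ‖g‖ + ε / 2 by rw [← norm_def]; linarith)
  have hr0 := hr.1
  have hs0 := hs.1
  have hmem : r + s ∈ normSet (f + g) := by
    refine ⟨by linarith, ?_⟩
    have h : (fun x => (f + g : LpVar p) x / (r + s)) =ᵐ[μ]
        fun x => r / (r + s) * (f x / r) + s / (r + s) * (g x / s) := by
      filter_upwards [coeFn_add f g] with x hx
      rw [hx]
      field_simp
    rw [modular_congr p h]
    have ha : 0 ≤ r / (r + s) := by positivity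
    have hb : 0 ≤ s / (r + s) := by positivity
    have hab : r / (r + s) + s / (r + s) = 1 := by field_simp
    have hfm : AEStronglyMeasurable (fun x => f x / r) μ := by
      simp_rw [div_eq_inv_mul]
      exact (aestronglyMeasurable f).const_mul _
    refine (modular_convex p hfm ha hb hab).trans ?_
    calc ENNReal.ofReal (r / (r + s)) * modular p (fun x => f x / r) +
          ENNReal.ofReal (s / (r + s)) * modular p (fun x => g x / s)
        ≤ ENNReal.ofReal (r / (r + s)) * 1 + ENNReal.ofReal (s / (r + s)) * 1 := by
          gcongr
          · exact hr.2
          · exact hs.2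
      _ = 1 := by
          rw [mul_one, mul_one, ← ENNReal.ofReal_add ha hb, hab, ENNReal.ofReal_one]
  have := norm_le_of_mem hmem
  linarith

theorem smul_mem_normSet {f : LpVar p} {c r : ℝ} (hc : c ≠ 0) (hr : r ∈ normSet f) :
    |c| * r ∈ normSet (c • f) := by
  have hr0 := hr.1
  have hc0 : 0 < |c| := abs_pos.2 hc
  refine ⟨by positivity, ?_⟩
  have h : (fun x => (c • f : LpVar p) x / (|c| * r)) =ᵐ[μ] fun x => (c / |c|) * (f x / r) := by
    filter_upwards [coeFn_smul c f] with x hx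
    rw [hx]
    field_simp
  rw [modular_congr p h, ← modular_abs]
  have h1 : abs (c / |c|) = 1 := by rw [abs_div, abs_abs, div_self hc0.ne']
  simp only [h1, one_mul]
  exact hr.2

theorem norm_smul_le' (c : ℝ) (f : LpVar p) (hc : c ≠ 0) : ‖c • f‖ ≤ |c| * ‖f‖ := by
  have hc0 : 0 < |c| := abs_pos.2 hc
  rw [← div_le_iff₀' hc0]
  refine le_csInf (normSet_nonempty f) fun r hr => ?_
  rw [div_le_iff₀' hc0]
  exact norm_le_of_mem (smul_mem_normSet hc hr)

theorem norm_smul' (c : ℝ) (f : LpVar p) : ‖c • f‖ = ‖c‖ * ‖f‖ := by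
  rw [Real.norm_eq_abs]
  rcases eq_or_ne c 0 with rfl | hc
  · rw [zero_smul, norm_zero', abs_zero, zero_mul]
  · refine le_antisymm (norm_smul_le' c f hc) ?_
    have h := norm_smul_le' c⁻¹ (c • f) (inv_ne_zero hc)
    rw [inv_smul_smul₀ hc, abs_inv] at h
    rwa [le_inv_mul_iff₀ (abs_pos.2 hc)] at h

theorem eq_zero_of_norm (f : LpVar p) (h : ‖f‖ = 0) : f = 0 := by
  have hsmall : ∀ ε : ℝ, 0 < ε → ε ≤ 1 → modular p f ≤ ENNReal.ofReal ε := by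
    intro ε hε hε1
    obtain ⟨r, hr, hrε⟩ := exists_lt_of_csInf_lt (normSet_nonempty f)
      (show sInf (normSet f) < ε by rw [← norm_def]; linarith)
    have hr0 := hr.1
    have hfr : (fun x => r * (f x / r)) = (f : α → ℝ) := by
      funext x
      field_simp
    calc modular p f = modular p (fun x => r * (f x / r)) := by rw [hfr]
      _ ≤ ENNReal.ofReal r * modular p (fun x => f x / r) :=
          modular_const_mul_le p hr0.le (by linarith)
      _ ≤ ENNReal.ofReal r * 1 := by gcongr; exact hr.2
      _ ≤ ENNReal.ofReal ε := by rw [mul_one]; exact ENNReal.ofReal_le_ofReal hrε.le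
  have h0 : modular p f = 0 := by
    by_contra hne
    have hpos : 0 < (modular p f).toReal := ENNReal.toReal_pos hne (modular_lt_top f).ne
    have h1 := hsmall (min 1 ((modular p f).toReal / 2)) (by positivity) (min_le_left _ _)
    have h2 := ENNReal.toReal_mono ENNReal.ofReal_ne_top h1
    rw [ENNReal.toReal_ofReal (by positivity)] at h2
    have h3 := min_le_right 1 ((modular p f).toReal / 2)
    linarith
  unfold modular at h0
  rw [lintegral_eq_zero_iff' (aemeasurable_modular p (aestronglyMeasurable f))] at h0
  refine ext ?_
  filter_upwards [h0, p.ae_one_le_toReal, coeFn_zero (p := p)] with x hx h1 h2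
  rw [h2]
  have hx' : ‖f x‖ₑ ^ (p.toFun x).toReal = 0 := hx
  rw [ENNReal.rpow_eq_zero_iff_of_pos (by linarith)] at hx'
  simpa using hx'

theorem normCore : NormedSpace.Core ℝ (LpVar p) where
  norm_nonneg := norm_nonneg'
  norm_smul := norm_smul'
  norm_triangle := norm_add_le'
  norm_eq_zero_iff f := ⟨eq_zero_of_norm f, by rintro rfl; exact norm_zero'⟩

noncomputable instance instNormedAddCommGroup : NormedAddCommGroup (LpVar p) :=
  fast_instance% NormedAddCommGroup.ofCore normCore

noncomputable instance instNormedSpace : NormedSpace ℝ (LpVar p) :=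
  fast_instance% NormedSpace.ofCore normCore

end LpVar

/-- The duality pairing `⟨ξ, v⟩ = ∫ ξ v dμ` between `L^{p'(x)}` and `L^{p(x)}`. -/
noncomputable def pairing {p : Exponent μ} (ξ : LpVar p.conj) (v : LpVar p) : ℝ :=
  ∫ x, ξ x * v x ∂μ

/-- The integrand of the duality pairing is integrable. -/
theorem integrable_pairing {p : Exponent μ} (ξ : LpVar p.conj) (v : LpVar p) :
    Integrable (fun x => ξ x * v x) μ := by
  refine ⟨ξ.aestronglyMeasurable.mul v.aestronglyMeasurable, ?_⟩
  refine lt_of_le_of_lt ?_ (ENNReal.add_lt_top.2 ⟨ξ.modular_lt_top, v.modular_lt_top⟩)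
  unfold modular
  rw [← lintegral_add_left' (aemeasurable_modular _ ξ.aestronglyMeasurable)]
  apply lintegral_mono_ae
  filter_upwards [p.ae_one_lt, p.ae_lt_top, p.ae_one_le_toReal, p.conj.ae_one_le_toReal]
    with x h1 h2 h3 h4
  have hh : (p.conj.toFun x).HolderConjugate (p.toFun x) := by
    have : (p.toFun x).HolderConjugate (p.conj.toFun x) := .conjExponent h1.le
    exact this.symm
  have hr : (p.conj.toFun x).toReal.HolderConjugate (p.toFun x).toReal := by
    have := ENNReal.HolderTriple.toReal (p := p.conj.toFun x) (q := p.toFun x) 1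
      (by linarith) (by linarith)
    simpa using this
  rw [enorm_mul]
  refine (ENNReal.young_inequality _ _ hr).trans ?_
  gcongr
  · exact ENNReal.div_le_of_le_mul (le_mul_of_one_le_right' (by simpa using h4))
  · exact ENNReal.div_le_of_le_mul (le_mul_of_one_le_right' (by simpa using h3))

/-- The subdifferential of `F : L^{p(x)} → (-∞, ∞]` at `u`, as a subset of `L^{p'(x)}`. -/
def subdifferential {p : Exponent μ} (F : LpVar p → EReal) (u : LpVar p) : Set (LpVar p.conj) :=
  {ξ | F u < ⊤ ∧ ∀ v : LpVar p, F u + (pairing ξ (v - u) : EReal) ≤ F v}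

/-- `φ` takes values in `(-∞, ∞]`, is not identically `∞`, lower semicontinuous and convex. -/
structure IsProperLscConvex {V : Type*} [NormedAddCommGroup V] [NormedSpace ℝ V]
    (φ : V → EReal) : Prop where
  ne_bot : ∀ v, φ v ≠ ⊥
  proper : ∃ v, φ v ≠ ⊤
  lsc : LowerSemicontinuous φ
  convex : ∀ v w : V, ∀ a b : ℝ, 0 ≤ a → 0 ≤ b → a + b = 1 →
    φ (a • v + b • w) ≤ (a : EReal) * φ v + (b : EReal) * φ w

end Space

section SpaceTime

variable {α : Type*} [MeasurableSpace α] {μ : Measure α}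

/-- The exponent `(x, t) ↦ p(x)` on the space-time cylinder over the time interval `(0, T)`. -/
noncomputable def Exponent.cyl (p : Exponent μ) (T : ℝ) :
    Exponent (μ.prod (volume.restrict (Ioo 0 T))) where
  toFun z := p.toFun z.1
  aemeasurable := p.aemeasurable.comp_quasiMeasurePreserving Measure.quasiMeasurePreserving_fst
  one_lt_essInf := by
    refine p.one_lt_essInf.trans_le (le_essInf_of_ae_le _ ?_)
    exact Measure.quasiMeasurePreserving_fst.ae (ae_essInf_le (μ := μ) (f := p.toFun))
  essSup_lt_top := by
    refine lt_of_le_of_lt (essSup_le_of_ae_le _ ?_) p.essSup_lt_top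
    exact Measure.quasiMeasurePreserving_fst.ae (ENNReal.ae_le_essSup p.toFun)

open Classical in
/-- The pointwise evaluation operator `P`: `(P u)(t) = u(·, t)`, an element of `L^{p(x)}` for almost
every `t` (and set to `0` at the remaining `t`). -/
noncomputable def timeEval {p : Exponent μ} {T : ℝ} (u : LpVar (p.cyl T)) (t : ℝ) : LpVar p :=
  if h : AEStronglyMeasurable (fun x => u (x, t)) μ ∧ modular p (fun x => u (x, t)) < ∞ then
    LpVar.mk (fun x => u (x, t)) h.1 h.2
  else 0

open Classical in
/-- `Φ(u) = ∫₀ᵀ φ((P u)(t)) dt` if `t ↦ φ((P u)(t))` is in `L¹(0, T)`, and `Φ(u) = ∞` otherwise. -/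
noncomputable def Phi {p : Exponent μ} {T : ℝ} (φ : LpVar p → EReal) (u : LpVar (p.cyl T)) :
    EReal :=
  if (∀ᵐ t ∂(volume.restrict (Ioo 0 T)), φ (timeEval u t) < ⊤) ∧
      Integrable (fun t => (φ (timeEval u t)).toReal) (volume.restrict (Ioo 0 T)) then
    ((∫ t in Ioo 0 T, (φ (timeEval u t)).toReal : ℝ) : EReal)
  else ⊤

end SpaceTime

/-- `g` is the weak (distributional) derivative `∂_t u` of `u` in `Q = Ω × (0, T)`. -/
def IsWeakTimeDeriv {N : ℕ} (Ω : Set (EuclideanSpace ℝ (Fin N))) (T : ℝ)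
    (u g : EuclideanSpace ℝ (Fin N) × ℝ → ℝ) : Prop :=
  ∀ ψ : EuclideanSpace ℝ (Fin N) × ℝ → ℝ, ContDiff ℝ (⊤ : ℕ∞) ψ → HasCompactSupport ψ →
    tsupport ψ ⊆ Ω ×ˢ Ioo 0 T →
    ∫ z in Ω ×ˢ Ioo 0 T, u z * deriv (fun s => ψ (z.1, s)) z.2 =
      -∫ z in Ω ×ˢ Ioo 0 T, g z * ψ z

end VarLebesgue

/-! Testing the weak derivative with products and a countable family of functions of time gives
`u(x,t) = c(x) + ∫ ∂ₜu(x,τ) dτ` over `τ < t`, almost everywhere (`exists_ae_eq_add_timePrimitive`).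
Jensen's inequality in time, at fixed `x`, bounds the Luxemburg norm of an increment by the integral
of an integrable function of time, so this formula defines an absolutely continuous curve `U`
(`exists_absolutelyContinuous_representative`).

For the integrated chain rule, the subgradient inequality for `Φ` is localised to a time interval
`(a, b)` and tested there with the translate `u(·, t + h)`. On the right, the difference of `φ(Pu)`
and its translate telescopes to averages near `b` and `a`. Dividing by `h > 0` and by `h < 0` gives
opposite inequalities, and `h → 0` turns them into an equality at Lebesgue points `a`, `b` of
`φ(Pu)` (`sub_eq_integral_of_hasDerivAt`). The limit uses no density argument: the exponent does not
depend on time, so Young's inequality `|ξ(x,s) w(x,t)| ≤ |ξ(x,s)|^{p'(x)} + |w(x,t)|^{p(x)}` holds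
at two different times, and the averages are dominated by averages whose integrals converge
(`tendsto_integral_mul_average`).

Thus `φ(U)` agrees on a set of full measure with a continuous primitive `F`. Lower semicontinuity
gives `φ(U(t)) ≤ F(t)` everywhere; the reverse inequality comes from testing with the frozen state
`U(t)` on a short interval (`integral_sub_le_of_Icc`). The pointwise chain rule is first-order
optimality: `φ(U(s)) - ⟨η, U(s)⟩` is minimal at `s = t`. -/

namespace VarLebesgue

/-! ### Averages over short intervals on the real line. -/

section RealAnalysis

/-- Dominated convergence with a convergent sequence of bounds. -/
theorem tendsto_integral_of_tendsto_bound {α : Type*} [MeasurableSpace α] {μ : Measure α}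
    {F G : ℕ → α → ℝ} {f g : α → ℝ}
    (hF : ∀ n, AEStronglyMeasurable (F n) μ) (hG : ∀ n, Integrable (G n) μ) (hg : Integrable g μ)
    (hFG : ∀ n, ∀ᵐ x ∂μ, |F n x| ≤ G n x)
    (hFf : ∀ᵐ x ∂μ, Tendsto (fun n => F n x) atTop (𝓝 (f x)))
    (hGg : ∀ᵐ x ∂μ, Tendsto (fun n => G n x) atTop (𝓝 (g x)))
    (hint : Tendsto (fun n => ∫ x, G n x ∂μ) atTop (𝓝 (∫ x, g x ∂μ))) :
    Tendsto (fun n => ∫ x, F n x ∂μ) atTop (𝓝 (∫ x, f x ∂μ)) := by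
  have hFG' : ∀ᵐ x ∂μ, ∀ n, |F n x| ≤ G n x := ae_all_iff.2 hFG
  have hfg : ∀ᵐ x ∂μ, |f x| ≤ g x := by
    filter_upwards [hFG', hFf, hGg] with x h1 h2 h3
    exact le_of_tendsto_of_tendsto' h2.abs h3 h1
  have hFint : ∀ n, Integrable (F n) μ := fun n => (hG n).mono' (hF n) (hFG n)
  -- Clipping `F n` to `[-g, g]` makes ordinary dominated convergence applicable; the clipping error
  -- is at most the positive part of `G n - g`.
  set H : ℕ → α → ℝ := fun n x => max (-g x) (min (g x) (F n x)) with hH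
  have hHm : ∀ n, AEStronglyMeasurable (H n) μ := fun n =>
    hg.1.neg.sup (hg.1.inf (hF n))
  have hHb : ∀ n, ∀ᵐ x ∂μ, ‖H n x‖ ≤ g x := by
    intro n
    filter_upwards [hfg] with x hx
    have : 0 ≤ g x := (abs_nonneg _).trans hx
    rw [Real.norm_eq_abs, abs_le]
    exact ⟨le_max_left _ _, max_le (by linarith) (min_le_left _ _)⟩
  have hHlim : Tendsto (fun n => ∫ x, H n x ∂μ) atTop (𝓝 (∫ x, f x ∂μ)) := by
    refine tendsto_integral_of_dominated_convergence g hHm hg hHb ?_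
    filter_upwards [hfg, hFf] with x h1 h2
    have h3 := (tendsto_const_nhds (x := -g x)).max ((tendsto_const_nhds (x := g x)).min h2)
    rwa [min_eq_right (abs_le.1 h1).2, max_eq_right (abs_le.1 h1).1] at h3
  have hNlim : Tendsto (fun n => ∫ x, max (g x - G n x) 0 ∂μ) atTop (𝓝 (∫ _, (0 : ℝ) ∂μ)) := by
    refine tendsto_integral_of_dominated_convergence g
      (fun n => (hg.sub (hG n)).pos_part.1) hg ?_ ?_
    · intro n
      filter_upwards [hfg, hFG n] with x h1 h2
      have h3 : 0 ≤ g x := (abs_nonneg _).trans h1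
      have h4 : 0 ≤ G n x := (abs_nonneg _).trans h2
      rw [Real.norm_of_nonneg (le_max_right _ _)]
      exact max_le (by linarith) h3
    · filter_upwards [hGg] with x h1
      have h3 := ((tendsto_const_nhds (x := g x)).sub h1).max (tendsto_const_nhds (x := (0 : ℝ)))
      simpa using h3
  -- The positive part is `G n - g` plus the negative part; the former has vanishing integral in the
  -- limit by `hint`, the latter is dominated by `g`.
  have hPlim : Tendsto (fun n => ∫ x, max (G n x - g x) 0 ∂μ) atTop (𝓝 0) := by
    have h1 : ∀ n, ∫ x, max (G n x - g x) 0 ∂μ =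
        (∫ x, G n x ∂μ) - (∫ x, g x ∂μ) + ∫ x, max (g x - G n x) 0 ∂μ := by
      intro n
      rw [← integral_sub (hG n) hg]
      refine Eq.trans ?_ (integral_add ((hG n).sub hg) (hg.sub (hG n)).pos_part)
      congr 1
      ext x
      rcases le_total (G n x) (g x) with h | h
      · rw [max_eq_right (by linarith), max_eq_left (by linarith)]; ring
      · rw [max_eq_left (by linarith), max_eq_right (by linarith)]; ring
    simp_rw [h1]
    have h2 := (hint.sub_const (∫ x, g x ∂μ)).add hNlim
    simpa using h2
  have hdiff : Tendsto (fun n => (∫ x, F n x ∂μ) - ∫ x, H n x ∂μ) atTop (𝓝 0) := by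
    refine squeeze_zero_norm (fun n => ?_) hPlim
    have hHi : Integrable (H n) μ := hg.mono' (hHm n) (hHb n)
    rw [← integral_sub (hFint n) hHi]
    refine norm_integral_le_of_norm_le ((hG n).sub hg).pos_part ?_
    filter_upwards [hfg, hFG n] with x h1 h2
    have h3 : 0 ≤ g x := (abs_nonneg _).trans h1
    have h4 := abs_le.1 h2
    rw [Real.norm_eq_abs, abs_le]
    simp only [hH]
    constructor <;> rcases le_total (g x) (F n x) with h5 | h5 <;>
      rcases le_total (-g x) (F n x) with h6 | h6 <;>
      rcases le_total (G n x) (g x) with h7 | h7 <;>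
      simp [h5, h6, h7, h3] <;> linarith
  have := hdiff.add hHlim
  simpa using this

theorem integral_comp_add_sub {f : ℝ → ℝ} {a b h : ℝ}
    (h1 : IntervalIntegrable f volume (a + h) (b + h)) (h2 : IntervalIntegrable f volume a b)
    (h3 : IntervalIntegrable f volume (a + h) a) :
    ∫ t in a..b, (f (t + h) - f t) = (∫ t in b..b + h, f t) - ∫ t in a..a + h, f t := by
  have h4 : IntervalIntegrable (fun t => f (t + h)) volume a b := by
    simpa using h1.comp_add_right h
  rw [intervalIntegral.integral_sub h4 h2, intervalIntegral.integral_comp_add_right]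
  have e1 := intervalIntegral.integral_interval_sub_interval_comm' h1 h2 h3
  rw [e1]

/-- Rescaling to `[0, 1]` treats both signs of `h` at once, so that later estimates of averages need
no case distinction. -/
theorem average_eq_integral_comp (f : ℝ → ℝ) (t : ℝ) {h : ℝ} (hh : h ≠ 0) :
    h⁻¹ * ∫ τ in t..t + h, f τ = ∫ σ in (0 : ℝ)..1, f (t + h * σ) := by
  rw [intervalIntegral.integral_comp_add_mul _ hh]
  simp

theorem abs_mul_average_le {f B : ℝ → ℝ} {c A t h : ℝ} (hf : Integrable f) (hB : Integrable B)
    (hAB : ∀ τ, |c * f τ| ≤ A + B τ) (hh : h ≠ 0) :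
    |c * (h⁻¹ * ∫ τ in t..t + h, f τ)| ≤ A + h⁻¹ * ∫ τ in t..t + h, B τ := by
  rw [average_eq_integral_comp f t hh, average_eq_integral_comp B t hh,
    ← intervalIntegral.integral_const_mul]
  have hc : ∀ k : ℝ → ℝ, Integrable k → IntervalIntegrable (fun σ => k (t + h * σ)) volume 0 1 := by
    intro k hk
    have := (hk.comp_add_left t).comp_mul_left' hh
    exact this.intervalIntegrable
  have h1 : (A : ℝ) + ∫ σ in (0 : ℝ)..1, B (t + h * σ) = ∫ σ in (0 : ℝ)..1, (A + B (t + h * σ)) := by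
    rw [intervalIntegral.integral_add (by simp) (hc B hB)]
    simp
  rw [h1]
  refine (intervalIntegral.abs_integral_le_integral_abs zero_le_one).trans ?_
  refine intervalIntegral.integral_mono_on zero_le_one ((hc f hf).const_mul c).abs
    ((by simp : IntervalIntegrable (fun _ => A) volume 0 1).add (hc B hB)) fun σ _ => hAB _

theorem tendsto_average_of_continuous {P : ℝ → ℝ} (hP : Continuous P) (t : ℝ) {h : ℕ → ℝ}
    (h0 : ∀ n, h n ≠ 0) (hlim : Tendsto h atTop (𝓝 0)) :
    Tendsto (fun n => (h n)⁻¹ * ∫ τ in t..t + h n, P τ) atTop (𝓝 (P t)) := by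
  have h1 : HasDerivAt (fun x => ∫ τ in t..x, P τ) (P t) t :=
    intervalIntegral.integral_hasDerivAt_right (hP.intervalIntegrable _ _)
      (hP.stronglyMeasurableAtFilter _ _) hP.continuousAt
  have h2 := h1.tendsto_slope_zero.comp
    (tendsto_nhdsWithin_iff.2 ⟨hlim, Eventually.of_forall h0⟩)
  simpa [Function.comp_def] using h2

theorem continuous_integral_Iic {B : ℝ → ℝ} (hB : Integrable B) :
    Continuous fun t => ∫ τ in Iic t, B τ := by
  have h1 : (fun t => ∫ τ in Iic t, B τ) = fun t => (∫ τ in Iic 0, B τ) + ∫ τ in (0 : ℝ)..t, B τ := by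
    ext t
    rw [← intervalIntegral.integral_Iic_sub_Iic hB.integrableOn hB.integrableOn]
    ring
  rw [h1]
  exact continuous_const.add (intervalIntegral.continuous_primitive (fun _ _ => hB.intervalIntegrable) 0)

/-- Each average is a difference quotient of the primitive of `B`, so its integral telescopes. This
gives both the uniform bound and the limit as `h → 0`. -/
theorem integral_average_eq {B : ℝ → ℝ} (hB : Integrable B) (a b h : ℝ) :
    ∫ t in a..b, (h⁻¹ * ∫ τ in t..t + h, B τ) =
      (h⁻¹ * ∫ t in b..b + h, ∫ τ in Iic t, B τ) - h⁻¹ * ∫ t in a..a + h, ∫ τ in Iic t, B τ := by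
  have hc := continuous_integral_Iic hB
  rw [← mul_sub, ← integral_comp_add_sub (hc.intervalIntegrable _ _) (hc.intervalIntegrable _ _)
    (hc.intervalIntegrable _ _), ← intervalIntegral.integral_const_mul]
  congr 1
  ext t
  rw [intervalIntegral.integral_Iic_sub_Iic hB.integrableOn hB.integrableOn]

theorem continuous_average {B : ℝ → ℝ} (hB : Integrable B) (h : ℝ) :
    Continuous fun t => h⁻¹ * ∫ τ in t..t + h, B τ := by
  have hc := continuous_integral_Iic hB
  have h1 : (fun t => ∫ τ in t..t + h, B τ) =
      fun t => (∫ τ in Iic (t + h), B τ) - ∫ τ in Iic t, B τ := by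
    ext t
    rw [intervalIntegral.integral_Iic_sub_Iic hB.integrableOn hB.integrableOn]
  have h2 : Continuous fun t => ∫ τ in t..t + h, B τ := by
    rw [h1]
    exact (hc.comp (continuous_id.add continuous_const)).sub hc
  exact continuous_const.mul h2

/-- After telescoping, what remains is a difference of two averages of the primitive of `B`, whose
values lie between `0` and `∫ B`. -/
theorem integral_average_le {B : ℝ → ℝ} (hB : Integrable B) (hB0 : ∀ t, 0 ≤ B t) (a b : ℝ) {h : ℝ}
    (hh : h ≠ 0) : ∫ t in a..b, (h⁻¹ * ∫ τ in t..t + h, B τ) ≤ ∫ t, B t := by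
  have hc := continuous_integral_Iic hB
  rw [integral_average_eq hB, average_eq_integral_comp _ _ hh, average_eq_integral_comp _ _ hh]
  have hcc : ∀ t : ℝ, IntervalIntegrable (fun σ => ∫ τ in Iic (t + h * σ), B τ) volume 0 1 :=
    fun t => (hc.comp (by fun_prop : Continuous fun σ : ℝ => t + h * σ)).intervalIntegrable _ _
  have h1 : ∫ σ in (0 : ℝ)..1, (∫ τ in Iic (b + h * σ), B τ) ≤ ∫ σ in (0 : ℝ)..1, ∫ t, B t :=
    intervalIntegral.integral_mono_on zero_le_one (hcc b) (by simp) fun σ _ =>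
      setIntegral_le_integral hB (Eventually.of_forall hB0)
  have h2 : 0 ≤ ∫ σ in (0 : ℝ)..1, (∫ τ in Iic (a + h * σ), B τ) :=
    intervalIntegral.integral_nonneg zero_le_one fun σ _ => integral_nonneg hB0
  simp only [intervalIntegral.integral_const, sub_zero, one_smul] at h1
  linarith

/-- The bound does not depend on `h`; applied to sections at fixed `x`, it supplies the dominating
function for the integral over `x`. -/
theorem abs_integral_mul_average_le {f g A B : ℝ → ℝ} (hf : Integrable f)
    (hA : Integrable A) (hB : Integrable B) (hA0 : ∀ t, 0 ≤ A t) (hB0 : ∀ t, 0 ≤ B t)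
    (hAB : ∀ s t, |g s * f t| ≤ A s + B t) {a b h : ℝ} (hab : a ≤ b) (hh : h ≠ 0) :
    |∫ t in a..b, g t * (h⁻¹ * ∫ τ in t..t + h, f τ)| ≤ (∫ t, A t) + ∫ t, B t := by
  have key : ‖∫ t in a..b, g t * (h⁻¹ * ∫ τ in t..t + h, f τ)‖ ≤
      ∫ t in a..b, (A t + h⁻¹ * ∫ τ in t..t + h, B τ) := by
    refine intervalIntegral.norm_integral_le_of_norm_le hab ?_
      (hA.intervalIntegrable.add ((continuous_average hB h).intervalIntegrable _ _))
    exact Eventually.of_forall fun t _ => abs_mul_average_le hf hB (hAB t) hh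
  refine key.trans ?_
  · rw [intervalIntegral.integral_add hA.intervalIntegrable
      ((continuous_average hB h).intervalIntegrable _ _)]
    refine add_le_add ?_ (integral_average_le hB hB0 a b hh)
    rw [intervalIntegral.integral_of_le hab]
    exact setIntegral_le_integral hA (Eventually.of_forall hA0)

/-- The averages converge almost everywhere by Lebesgue differentiation. A fixed integrable majorant
is not at hand, but `A` plus the average of `B` is a majorant converging almost everywhere and in
integral. -/
theorem tendsto_integral_mul_average {f g A B : ℝ → ℝ} (hf : Integrable f)
    (hg : AEStronglyMeasurable g) (hA : Integrable A) (hB : Integrable B)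
    (hAB : ∀ s t, |g s * f t| ≤ A s + B t) {h : ℕ → ℝ}
    (h0 : ∀ n, h n ≠ 0) (hlim : Tendsto h atTop (𝓝 0)) {a b : ℝ} (hab : a ≤ b) :
    Tendsto (fun n => ∫ t in a..b, g t * ((h n)⁻¹ * ∫ τ in t..t + h n, f τ)) atTop
      (𝓝 (∫ t in a..b, g t * f t)) := by
  have hav : ∀ k : ℝ → ℝ, Integrable k → ∀ᵐ t ∂(volume.restrict (Ioc a b)),
      Tendsto (fun n => (h n)⁻¹ * ∫ τ in t..t + h n, k τ) atTop (𝓝 (k t)) := by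
    intro k hk
    filter_upwards [ae_restrict_of_ae (LocallyIntegrable.ae_hasDerivAt_integral hk.locallyIntegrable)] with t ht
    have h2 := (ht t).tendsto_slope_zero.comp
      (tendsto_nhdsWithin_iff.2 ⟨hlim, Eventually.of_forall h0⟩)
    simpa [Function.comp_def] using h2
  simp_rw [intervalIntegral.integral_of_le hab]
  refine tendsto_integral_of_tendsto_bound
    (G := fun n t => A t + (h n)⁻¹ * ∫ τ in t..t + h n, B τ) (g := fun t => A t + B t)
    (fun n => (hg.restrict).mul (continuous_average hf (h n)).aestronglyMeasurable)
    (fun n => hA.integrableOn.add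
      ((continuous_average hB (h n)).intervalIntegrable a b).1)
    (hA.integrableOn.add hB.integrableOn)
    (fun n => Eventually.of_forall fun t => abs_mul_average_le hf hB (hAB t) (h0 n)) ?_ ?_ ?_
  · filter_upwards [hav f hf] with t ht using ht.const_mul _
  · filter_upwards [hav B hB] with t ht using ht.const_add _
  · have h1 : ∀ n, ∫ t in Ioc a b, (A t + (h n)⁻¹ * ∫ τ in t..t + h n, B τ) =
        (∫ t in Ioc a b, A t) + ∫ t in a..b, (h n)⁻¹ * ∫ τ in t..t + h n, B τ := by
      intro n
      rw [integral_add hA.integrableOn ((continuous_average hB (h n)).intervalIntegrable a b).1,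
        intervalIntegral.integral_of_le hab]
    simp_rw [h1]
    rw [integral_add hA.integrableOn hB.integrableOn]
    refine Tendsto.const_add _ ?_
    simp_rw [integral_average_eq hB]
    have hc := continuous_integral_Iic hB
    have := (tendsto_average_of_continuous hc b h0 hlim).sub
      (tendsto_average_of_continuous hc a h0 hlim)
    rwa [intervalIntegral.integral_Iic_sub_Iic hB.integrableOn hB.integrableOn,
      intervalIntegral.integral_of_le hab] at this

/-- Transfers absolute continuity from a real primitive to a curve whose increments it controls,
with the same `δ`. -/
theorem absolutelyContinuousOnInterval_of_dist_le {X Y : Type*} [PseudoMetricSpace X]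
    [PseudoMetricSpace Y] {U : ℝ → X} {F : ℝ → Y} {a b : ℝ}
    (hF : AbsolutelyContinuousOnInterval F a b)
    (h : ∀ s ∈ uIcc a b, ∀ t ∈ uIcc a b, dist (U s) (U t) ≤ dist (F s) (F t)) :
    AbsolutelyContinuousOnInterval U a b := by
  rw [absolutelyContinuousOnInterval_iff] at hF ⊢
  intro ε hε
  obtain ⟨δ, hδ, H⟩ := hF ε hε
  refine ⟨δ, hδ, fun E hE hlen => lt_of_le_of_lt (Finset.sum_le_sum fun i hi => ?_) (H E hE hlen)⟩
  exact h _ (hE.1 i hi).1 _ (hE.1 i hi).2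

end RealAnalysis

/-! ### Weak derivatives in one variable through countably many test functions. -/

section WeakDerivative

/-- Smooth approximation of the indicator function of `(q, r)` from below. -/
noncomputable def cutoff (q r : ℝ) (n : ℕ) (t : ℝ) : ℝ :=
  Real.smoothTransition (n * (t - q)) * Real.smoothTransition (n * (r - t))

theorem contDiff_cutoff (q r : ℝ) (n : ℕ) : ContDiff ℝ (⊤ : ℕ∞) (cutoff q r n) := by
  unfold cutoff
  exact (Real.smoothTransition.contDiff.comp (by fun_prop)).mul
    (Real.smoothTransition.contDiff.comp (by fun_prop))

theorem cutoff_eq_zero {q r t : ℝ} (n : ℕ) (ht : t ∉ Ioo q r) : cutoff q r n t = 0 := by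
  have hn : (0 : ℝ) ≤ n := n.cast_nonneg
  rcases le_or_gt t q with h | h
  · have : Real.smoothTransition (n * (t - q)) = 0 :=
      Real.smoothTransition.zero_of_nonpos (mul_nonpos_of_nonneg_of_nonpos hn (by linarith))
    rw [cutoff, this, zero_mul]
  · have h2 : r ≤ t := by
      by_contra h3
      exact ht ⟨h, not_le.1 h3⟩
    have : Real.smoothTransition (n * (r - t)) = 0 :=
      Real.smoothTransition.zero_of_nonpos (mul_nonpos_of_nonneg_of_nonpos hn (by linarith))
    rw [cutoff, this, mul_zero]

theorem abs_cutoff_le_one (q r : ℝ) (n : ℕ) (t : ℝ) : |cutoff q r n t| ≤ 1 := by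
  rw [cutoff, abs_mul, abs_of_nonneg (Real.smoothTransition.nonneg _),
    abs_of_nonneg (Real.smoothTransition.nonneg _)]
  exact mul_le_one₀ (Real.smoothTransition.le_one _) (Real.smoothTransition.nonneg _)
    (Real.smoothTransition.le_one _)

theorem tendsto_cutoff (q r t : ℝ) :
    Tendsto (fun n => cutoff q r n t) atTop (𝓝 ((Ioo q r).indicator 1 t)) := by
  by_cases ht : t ∈ Ioo q r
  · rw [indicator_of_mem ht]
    have h1 : ∀ c : ℝ, 0 < c →
        Tendsto (fun n : ℕ => Real.smoothTransition (n * c)) atTop (𝓝 1) := by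
      intro c hc
      obtain ⟨N, hN⟩ := exists_nat_gt (1 / c)
      refine tendsto_const_nhds.congr' ?_
      filter_upwards [eventually_ge_atTop N] with n hn
      refine (Real.smoothTransition.one_of_one_le ?_).symm
      have : (N : ℝ) ≤ n := by exact_mod_cast hn
      rw [← div_le_iff₀ hc]
      linarith
    have := (h1 (t - q) (by linarith [ht.1])).mul (h1 (r - t) (by linarith [ht.2]))
    simpa [cutoff] using this
  · rw [indicator_of_notMem ht]
    simp_rw [cutoff_eq_zero _ ht]
    exact tendsto_const_nhds

/-- As `n → ∞` the integral of `h` over each rational interval vanishes, so its primitive is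
constant on the rationals, hence on `(0, T)`, and its derivative is `h` almost everywhere. The
countable family matters because the lemma is applied for almost every `x`, with one common null
set. -/
theorem ae_eq_zero_of_integral_cutoff {T : ℝ} {h : ℝ → ℝ} (hh : IntegrableOn h (Ioo 0 T))
    (h0 : ∀ q r : ℚ, (0 : ℝ) < q → (q : ℝ) < r → (r : ℝ) < T → ∀ n : ℕ,
      ∫ t in Ioo 0 T, h t * cutoff q r n t = 0) :
    ∀ᵐ t ∂(volume.restrict (Ioo 0 T)), h t = 0 := by
  set k : ℝ → ℝ := (Ioo 0 T).indicator h with hk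
  have hki : Integrable k := (integrable_indicator_iff measurableSet_Ioo).2 hh
  set F : ℝ → ℝ := fun t => ∫ τ in Iic t, k τ with hF
  have hFc : Continuous F := continuous_integral_Iic hki
  have hFq : ∀ q r : ℚ, (0 : ℝ) < q → (q : ℝ) < r → (r : ℝ) < T → F r = F q := by
    intro q r hq hqr hr
    have h1 : Tendsto (fun n => ∫ t in Ioo 0 T, h t * cutoff q r n t) atTop
        (𝓝 (∫ t in Ioo 0 T, h t * (Ioo (q : ℝ) r).indicator 1 t)) := by
      refine tendsto_integral_of_dominated_convergence (fun t => |h t|)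
        (fun n => hh.1.mul (contDiff_cutoff _ _ _).continuous.aestronglyMeasurable) hh.abs ?_ ?_
      · intro n
        refine Eventually.of_forall fun t => ?_
        rw [Real.norm_eq_abs, abs_mul]
        exact mul_le_of_le_one_right (abs_nonneg _) (abs_cutoff_le_one _ _ _ _)
      · exact Eventually.of_forall fun t => (tendsto_cutoff _ _ _).const_mul _
    simp_rw [h0 q r hq hqr hr] at h1
    have h2 := tendsto_nhds_unique h1 tendsto_const_nhds
    have h3 : F r - F q = ∫ t in Ioo 0 T, h t * (Ioo (q : ℝ) r).indicator 1 t := by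
      rw [hF]
      simp only
      rw [intervalIntegral.integral_Iic_sub_Iic hki.integrableOn hki.integrableOn,
        intervalIntegral.integral_of_le hqr.le, integral_Ioc_eq_integral_Ioo,
        ← integral_indicator measurableSet_Ioo, ← integral_indicator measurableSet_Ioo]
      congr 1
      ext t
      by_cases ht : t ∈ Ioo (q : ℝ) r
      · have ht' : t ∈ Ioo 0 T := ⟨hq.trans ht.1, ht.2.trans hr⟩
        simp [hk, ht, ht']
      · by_cases ht' : t ∈ Ioo 0 T <;> simp [ht, ht']
    rw [h2] at h3
    linarith
  have hFconst : ∀ s ∈ Ioo 0 T, ∀ t ∈ Ioo 0 T, F s = F t := by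
    have hd : Ioo 0 T ⊆ closure (Ioo 0 T ∩ range ((↑) : ℚ → ℝ)) :=
      Rat.denseRange_cast.open_subset_closure_inter isOpen_Ioo
    have hq : ∀ q r : ℚ, (q : ℝ) ∈ Ioo 0 T → (r : ℝ) ∈ Ioo 0 T → F r = F q := by
      intro q r hq hr
      rcases lt_trichotomy (q : ℝ) r with h | h | h
      · exact hFq q r hq.1 h hr.2
      · rw [h]
      · exact (hFq r q hr.1 h hq.2).symm
    have h1 : ∀ q : ℚ, (q : ℝ) ∈ Ioo 0 T → ∀ t ∈ Ioo 0 T, F t = F q := by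
      intro q hqm
      have : EqOn F (fun _ => F q) (Ioo 0 T ∩ range ((↑) : ℚ → ℝ)) := by
        rintro t ⟨ht, r, rfl⟩
        exact hq q r hqm ht
      exact this.of_subset_closure hFc.continuousOn continuousOn_const inter_subset_left hd
    intro s hs t ht
    obtain ⟨q, hq1, hq2⟩ := exists_rat_btwn (hs.1.trans hs.2)
    rw [h1 q ⟨hq1, hq2⟩ s hs, h1 q ⟨hq1, hq2⟩ t ht]
  filter_upwards [ae_restrict_of_ae (LocallyIntegrable.ae_hasDerivAt_integral hki.locallyIntegrable),
    ae_restrict_mem measurableSet_Ioo] with t h1 ht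
  have h2 : HasDerivAt F (k t) t := by
    have h3 := (h1 0).const_add (F 0)
    refine h3.congr_of_eventuallyEq (Eventually.of_forall fun s => ?_)
    simp only [hF]
    rw [← intervalIntegral.integral_Iic_sub_Iic hki.integrableOn hki.integrableOn]
    ring
  have h4 : HasDerivAt F 0 t := by
    refine (hasDerivAt_const t (F t)).congr_of_eventuallyEq ?_
    filter_upwards [Ioo_mem_nhds ht.1 ht.2] with s hs using hFconst s hs t ht
  have h5 := h2.unique h4
  rwa [hk, indicator_of_mem ht] at h5

/-- The compactly supported primitive of a corrected cutoff function. -/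
noncomputable def cutoffPrimitive (T : ℝ) (ρ : ℝ → ℝ) (q r : ℝ) (n : ℕ) (t : ℝ) : ℝ :=
  ∫ s in (0 : ℝ)..t, (cutoff q r n s - (∫ s in (0 : ℝ)..T, cutoff q r n s) * ρ s)

theorem hasDerivAt_cutoffPrimitive {ρ : ℝ → ℝ} (hρ : Continuous ρ) (T q r : ℝ) (n : ℕ) (t : ℝ) :
    HasDerivAt (cutoffPrimitive T ρ q r n)
      (cutoff q r n t - (∫ s in (0 : ℝ)..T, cutoff q r n s) * ρ t) t := by
  have hc : Continuous fun s => cutoff q r n s - (∫ s in (0 : ℝ)..T, cutoff q r n s) * ρ s :=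
    (contDiff_cutoff q r n).continuous.sub (continuous_const.mul hρ)
  exact intervalIntegral.integral_hasDerivAt_right (hc.intervalIntegrable _ _)
    (hc.stronglyMeasurableAtFilter _ _) hc.continuousAt

theorem contDiff_cutoffPrimitive {ρ : ℝ → ℝ} (hρ : ContDiff ℝ (⊤ : ℕ∞) ρ) (T q r : ℝ) (n : ℕ) :
    ContDiff ℝ (⊤ : ℕ∞) (cutoffPrimitive T ρ q r n) := by
  rw [contDiff_infty_iff_deriv]
  refine ⟨fun t => (hasDerivAt_cutoffPrimitive hρ.continuous T q r n t).differentiableAt, ?_⟩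
  have : deriv (cutoffPrimitive T ρ q r n) =
      fun t => cutoff q r n t - (∫ s in (0 : ℝ)..T, cutoff q r n s) * ρ t := by
    ext t
    exact (hasDerivAt_cutoffPrimitive hρ.continuous T q r n t).deriv
  rw [this]
  exact (contDiff_cutoff q r n).sub (contDiff_const.mul hρ)

/-- Subtracting the multiple of `ρ`, which has integral one, makes the integrand mean-free; hence
its primitive returns to zero to the right of its support. -/
theorem cutoffPrimitive_eq_zero {ρ : ℝ → ℝ} (hρ : Continuous ρ) {T a b q r : ℝ} (n : ℕ)
    (ha : 0 ≤ a) (hb : b ≤ T) (hρ1 : ∫ s in (0 : ℝ)..T, ρ s = 1)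
    (hρs : ∀ t, t ∉ Icc a b → ρ t = 0) (hq : a ≤ q) (hr : r ≤ b) {t : ℝ} (ht : t ∉ Icc a b) :
    cutoffPrimitive T ρ q r n t = 0 := by
  have hc : Continuous fun s => cutoff q r n s - (∫ s in (0 : ℝ)..T, cutoff q r n s) * ρ s :=
    (contDiff_cutoff q r n).continuous.sub (continuous_const.mul hρ)
  have hz : ∀ s, s ∉ Icc a b →
      cutoff q r n s - (∫ s in (0 : ℝ)..T, cutoff q r n s) * ρ s = 0 := by
    intro s hs
    rw [hρs s hs, cutoff_eq_zero n (fun h => hs ⟨hq.trans h.1.le, h.2.le.trans hr⟩)]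
    ring
  have hT : ∫ s in (0 : ℝ)..T, (cutoff q r n s - (∫ s in (0 : ℝ)..T, cutoff q r n s) * ρ s) = 0 := by
    rw [intervalIntegral.integral_sub ((contDiff_cutoff q r n).continuous.intervalIntegrable _ _)
      ((hρ.intervalIntegrable _ _).const_mul _), intervalIntegral.integral_const_mul, hρ1]
    ring
  unfold cutoffPrimitive
  rcases lt_or_ge t a with h | h
  · refine intervalIntegral.integral_zero_ae ?_
    -- The range of integration can meet `Icc a b` only when `t < 0` and `a = 0`, and then only in
    -- the point `a`.
    have h0 : ∀ᵐ s : ℝ, s ≠ a := by simp [ae_iff, measure_singleton]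
    filter_upwards [h0] with s hs hs'
    refine hz s fun h' => ?_
    rcases mem_uIoc.1 hs' with h1 | h1
    · linarith [h1.2, h'.1]
    · exact hs (le_antisymm (h1.2.trans ha) h'.1)
  · have hbt : b < t := by
      by_contra h2
      exact ht ⟨h, not_lt.1 h2⟩
    rw [← intervalIntegral.integral_add_adjacent_intervals (hc.intervalIntegrable 0 T)
      (hc.intervalIntegrable T t), hT, zero_add]
    refine intervalIntegral.integral_zero_ae ?_
    have h0 : ∀ᵐ s : ℝ, s ≠ b := by simp [ae_iff, measure_singleton]
    filter_upwards [h0] with s hs hs'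
    refine hz s fun h' => ?_
    rcases mem_uIoc.1 hs' with h1 | h1
    · linarith [h1.1, h'.2]
    · linarith [h1.1, h'.2]

theorem hasDerivAt_integral_Iic_ae {g : ℝ → ℝ} (hg : Integrable g) :
    ∀ᵐ t, HasDerivAt (fun t => ∫ τ in Iic t, g τ) (g t) t := by
  filter_upwards [LocallyIntegrable.ae_hasDerivAt_integral hg.locallyIntegrable] with t h1
  have h3 := (h1 0).const_add (∫ τ in Iic 0, g τ)
  refine h3.congr_of_eventuallyEq (Eventually.of_forall fun s => ?_)
  simp only
  rw [← intervalIntegral.integral_Iic_sub_Iic hg.integrableOn hg.integrableOn]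
  ring

theorem absolutelyContinuousOnInterval_integral_Iic {g : ℝ → ℝ} (hg : Integrable g) (a b : ℝ) :
    AbsolutelyContinuousOnInterval (fun t => ∫ τ in Iic t, g τ) a b := by
  refine absolutelyContinuousOnInterval_of_dist_le
    ((hg.intervalIntegrable (a := a) (b := b)).absolutelyContinuousOnInterval_intervalIntegral
      (c := a) (by simp)) fun s _ t _ => le_of_eq ?_
  rw [Real.dist_eq, Real.dist_eq,
    intervalIntegral.integral_Iic_sub_Iic hg.integrableOn hg.integrableOn,
    intervalIntegral.integral_interval_sub_left hg.intervalIntegrable hg.intervalIntegrable]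

/-- One-dimensional weak derivatives: testing against countably many functions suffices. -/
theorem ae_sub_integral_eq_const {T : ℝ} (hT : 0 < T) {ρ v g : ℝ → ℝ}
    (hρ : ContDiff ℝ (⊤ : ℕ∞) ρ) {a b : ℝ} (ha : 0 < a) (hb : b < T)
    (hρ1 : ∫ s in (0 : ℝ)..T, ρ s = 1) (hρs : ∀ t, t ∉ Icc a b → ρ t = 0)
    (hv : IntegrableOn v (Ioo 0 T)) (hg : Integrable g)
    (hvg : ∀ q r : ℚ, (0 : ℝ) < q → (q : ℝ) < r → (r : ℝ) < T → ∀ n : ℕ,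
      ∫ t in Ioo 0 T, (v t * deriv (cutoffPrimitive T ρ q r n) t +
        g t * cutoffPrimitive T ρ q r n t) = 0) :
    ∀ᵐ t ∂(volume.restrict (Ioo 0 T)),
      v t - ∫ τ in Iic t, g τ = ∫ s in Ioo 0 T, (v s - ∫ τ in Iic s, g τ) * ρ s := by
  set I : ℝ → ℝ := fun t => ∫ τ in Iic t, g τ with hI
  have hIc : Continuous I := continuous_integral_Iic hg
  have hbdd : ∀ k : ℝ → ℝ, Continuous k → ∀ w : ℝ → ℝ, IntegrableOn w (Ioo 0 T) →
      IntegrableOn (fun t => w t * k t) (Ioo 0 T) := by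
    intro k hk w hw
    obtain ⟨C, hC⟩ := isCompact_Icc.exists_bound_of_continuousOn (hk.continuousOn (s := Icc 0 T))
    refine hw.mul_bdd (c := C) hk.aestronglyMeasurable ?_
    filter_upwards [ae_restrict_mem measurableSet_Ioo] with t ht
    exact hC t (Ioo_subset_Icc_self ht)
  have hIi : IntegrableOn I (Ioo 0 T) :=
    (hIc.integrableOn_Icc (a := 0) (b := T)).mono_set Ioo_subset_Icc_self
  have hDi : IntegrableOn (fun t => v t - I t) (Ioo 0 T) := hv.sub hIi
  -- If `v - I` is to be constant, the constant must be its `ρ`-weighted mean.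
  set c : ℝ := ∫ s in Ioo 0 T, (v s - I s) * ρ s with hc
  have hfin : ∀ᵐ t ∂(volume.restrict (Ioo 0 T)), v t - I t - c = 0 := by
    refine ae_eq_zero_of_integral_cutoff
      (hDi.sub (integrableOn_const (by simp) : IntegrableOn (fun _ => c) (Ioo 0 T))) ?_
    intro q r hq hqr hr n
    set B := cutoffPrimitive T ρ q r n with hB
    have hBd : ContDiff ℝ (⊤ : ℕ∞) B := contDiff_cutoffPrimitive hρ T q r n
    have hB0 : ∀ t, t ∉ Icc (min a q) (max b r) → B t = 0 := fun t ht =>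
      cutoffPrimitive_eq_zero hρ.continuous n (le_min ha.le hq.le) (max_le hb.le hr.le) hρ1
        (fun s hs => hρs s fun h => hs ⟨(min_le_left _ _).trans h.1, h.2.trans (le_max_left _ _)⟩)
        (min_le_right _ _) (le_max_right _ _) ht
    have hB00 : B 0 = 0 := hB0 0 fun h => absurd h.1 (not_le.2 (lt_min ha hq))
    have hBT : B T = 0 := hB0 T fun h => absurd h.2 (not_le.2 (max_lt hb hr))
    have hdc : Continuous (deriv B) := hBd.continuous_deriv (by simp)
    -- Integrating by parts shows that `I` satisfies the same weak equation as `v`, so `v - I` is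
    -- orthogonal to `deriv B`.
    have hibp := AbsolutelyContinuousOnInterval.integral_mul_deriv_eq_deriv_mul
      (absolutelyContinuousOnInterval_integral_Iic hg 0 T)
      (ContDiffOn.absolutelyContinuousOnInterval (a := 0) (b := T)
        ((hBd.of_le (by simp)).contDiffOn))
    rw [hB00, hBT, mul_zero, mul_zero, sub_zero, zero_sub] at hibp
    have hdI : ∫ x in (0 : ℝ)..T, deriv (fun t => ∫ τ in Iic t, g τ) x * B x =
        ∫ x in (0 : ℝ)..T, g x * B x := by
      refine intervalIntegral.integral_congr_ae ?_
      filter_upwards [hasDerivAt_integral_Iic_ae hg] with t ht _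
      rw [ht.deriv]
    rw [hdI, intervalIntegral.integral_of_le hT.le, intervalIntegral.integral_of_le hT.le,
      integral_Ioc_eq_integral_Ioo, integral_Ioc_eq_integral_Ioo] at hibp
    have h1 := hvg q r hq hqr hr n
    have hgB : IntegrableOn (fun t => g t * B t) (Ioo 0 T) := hbdd B hBd.continuous g hg.integrableOn
    rw [integral_add (hbdd _ hdc v hv) hgB] at h1
    have h2 : ∫ t in Ioo 0 T, (v t - I t) * deriv B t = 0 := by
      simp_rw [sub_mul]
      rw [integral_sub (hbdd _ hdc v hv) (hbdd _ hdc I hIi)]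
      have h3 : ∫ t in Ioo 0 T, I t * deriv B t = -∫ t in Ioo 0 T, g t * B t := hibp
      rw [h3]
      linarith
    -- Since `deriv B` is the cutoff minus `k * ρ`, orthogonality to it is exactly orthogonality of
    -- `v - I - c` to the cutoff.
    set k := ∫ s in (0 : ℝ)..T, cutoff q r n s with hk
    have h4 : ∀ t, deriv B t = cutoff q r n t - k * ρ t := fun t =>
      (hasDerivAt_cutoffPrimitive hρ.continuous T q r n t).deriv
    simp_rw [h4, mul_sub] at h2
    have hi1 := hbdd _ (contDiff_cutoff q r n).continuous _ hDi
    have hi2 := hbdd _ hρ.continuous _ hDi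
    have h5 : ∀ t, (v t - I t) * (k * ρ t) = k * ((v t - I t) * ρ t) := fun t => by ring
    simp_rw [h5] at h2
    rw [integral_sub hi1 (hi2.const_mul k), integral_const_mul, ← hc] at h2
    have h6 : ∀ t, (v t - I t - c) * cutoff q r n t =
      (v t - I t) * cutoff q r n t - c * cutoff q r n t := fun t => by ring
    have hi3 : IntegrableOn (fun t => c * cutoff q r n t) (Ioo 0 T) :=
      ((continuous_const.mul (contDiff_cutoff q r n).continuous).integrableOn_Icc
        (a := 0) (b := T)).mono_set Ioo_subset_Icc_self
    simp_rw [h6]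
    rw [integral_sub hi1 hi3, integral_const_mul, ← integral_Ioc_eq_integral_Ioo (f := cutoff q r n),
      ← intervalIntegral.integral_of_le hT.le, ← hk]
    linarith
  filter_upwards [hfin] with t ht
  linarith

end WeakDerivative

/-! ### Truncated time sections and their jointly measurable primitives. -/

section TimePrimitive

variable {α : Type*}

/-- The section `w (x, ·)`, extended by zero outside `(0, T)`. -/
noncomputable def timeTrunc (T : ℝ) (w : α × ℝ → ℝ) (x : α) : ℝ → ℝ :=
  (Ioo 0 T).indicator fun τ => w (x, τ)

/-- The primitive in time of the section `w (x, ·)` on `(0, T)`. -/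
noncomputable def timePrimitive (T : ℝ) (w : α × ℝ → ℝ) (x : α) (t : ℝ) : ℝ :=
  ∫ τ in Iic t, timeTrunc T w x τ

theorem integrable_timeTrunc {T : ℝ} {w : α × ℝ → ℝ} {x : α} :
    Integrable (timeTrunc T w x) ↔ IntegrableOn (fun τ => w (x, τ)) (Ioo 0 T) :=
  integrable_indicator_iff measurableSet_Ioo

theorem timePrimitive_sub {T : ℝ} {w : α × ℝ → ℝ} {x : α} (h : Integrable (timeTrunc T w x))
    (s t : ℝ) : timePrimitive T w x t - timePrimitive T w x s = ∫ τ in s..t, timeTrunc T w x τ :=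
  intervalIntegral.integral_Iic_sub_Iic h.integrableOn h.integrableOn

variable [MeasurableSpace α]

theorem stronglyMeasurable_timeTrunc (T : ℝ) {w : α × ℝ → ℝ} (hw : StronglyMeasurable w) :
    StronglyMeasurable fun z : α × ℝ => timeTrunc T w z.1 z.2 := by
  have : (fun z : α × ℝ => timeTrunc T w z.1 z.2) = (univ ×ˢ Ioo 0 T).indicator w := by
    ext z
    by_cases hz : z.2 ∈ Ioo 0 T
    · rw [timeTrunc, indicator_of_mem hz, indicator_of_mem (by simpa using hz)]
    · rw [timeTrunc, indicator_of_notMem hz, indicator_of_notMem (by simpa using hz)]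
  rw [this]
  exact hw.indicator (MeasurableSet.univ.prod measurableSet_Ioo)

theorem stronglyMeasurable_timePrimitive (T : ℝ) {w : α × ℝ → ℝ} (hw : StronglyMeasurable w) :
    StronglyMeasurable fun z : α × ℝ => timePrimitive T w z.1 z.2 := by
  have h1 : (fun z : α × ℝ => timePrimitive T w z.1 z.2) = fun z : α × ℝ =>
      ∫ τ, ({y : (α × ℝ) × ℝ | y.2 ≤ y.1.2}.indicator fun y => timeTrunc T w y.1.1 y.2) (z, τ) := by
    ext z
    rw [timePrimitive, ← integral_indicator measurableSet_Iic]
    rfl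
  rw [h1]
  refine StronglyMeasurable.integral_prod_right' (f := {y : (α × ℝ) × ℝ | y.2 ≤ y.1.2}.indicator fun y => timeTrunc T w y.1.1 y.2) ?_
  refine StronglyMeasurable.indicator ?_
    (measurableSet_le measurable_snd (measurable_snd.comp measurable_fst))
  exact (stronglyMeasurable_timeTrunc T hw).comp_measurable
    ((measurable_fst.comp measurable_fst).prodMk measurable_snd)

end TimePrimitive

/-! ### From the weak time derivative to a primitive in time. -/

section Representation

variable {N : ℕ} {Ω : Set (EuclideanSpace ℝ (Fin N))} {T : ℝ}

/-- The product vanishes off the compact support of `a`, so integrability over compact subsets of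
the possibly unbounded `Ω` suffices. -/
theorem integrableOn_mul_test {w : EuclideanSpace ℝ (Fin N) × ℝ → ℝ} (hΩ : IsOpen Ω)
    (hw : ∀ K : Set (EuclideanSpace ℝ (Fin N)), IsCompact K → K ⊆ Ω →
      IntegrableOn w (K ×ˢ Ioo 0 T))
    {a : EuclideanSpace ℝ (Fin N) → ℝ} (ha : Continuous a) (hac : HasCompactSupport a)
    (has : tsupport a ⊆ Ω) {k : ℝ → ℝ} (hk : Continuous k) :
    IntegrableOn (fun z => w z * (a z.1 * k z.2)) (Ω ×ˢ Ioo 0 T) := by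
  have hK : IsCompact (tsupport a) := hac
  have hc : Continuous fun z : EuclideanSpace ℝ (Fin N) × ℝ => a z.1 * k z.2 :=
    (ha.comp continuous_fst).mul (hk.comp continuous_snd)
  have h1 : IntegrableOn (fun z => w z * (a z.1 * k z.2)) (tsupport a ×ˢ Ioo 0 T) := by
    obtain ⟨C, hC⟩ := (hK.prod (isCompact_Icc (a := (0 : ℝ)) (b := T))).exists_bound_of_continuousOn
      hc.continuousOn
    refine (hw _ hK has).mul_bdd (c := C) hc.aestronglyMeasurable ?_
    filter_upwards [ae_restrict_mem (hK.measurableSet.prod measurableSet_Ioo)] with z hz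
    exact hC z ⟨hz.1, Ioo_subset_Icc_self hz.2⟩
  refine h1.of_forall_sdiff_eq_zero (hΩ.measurableSet.prod measurableSet_Ioo) ?_
  rintro z ⟨hz1, hz2⟩
  have : z.1 ∉ tsupport a := fun h => hz2 ⟨h, hz1.2⟩
  simp [image_eq_zero_of_notMem_tsupport this]

/-- Testing with products `α(x) B(t)` shows that the time integral, as a function of `x`,
annihilates every smooth compactly supported `α`, so it vanishes almost everywhere. The exceptional
set depends on `B`. -/
theorem ae_integral_weak_eq_zero (hΩ : IsOpen Ω)
    {u g : EuclideanSpace ℝ (Fin N) × ℝ → ℝ}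
    (hu : ∀ K : Set (EuclideanSpace ℝ (Fin N)), IsCompact K → K ⊆ Ω →
      IntegrableOn u (K ×ˢ Ioo 0 T))
    (hg : ∀ K : Set (EuclideanSpace ℝ (Fin N)), IsCompact K → K ⊆ Ω →
      IntegrableOn g (K ×ˢ Ioo 0 T))
    (hw : IsWeakTimeDeriv Ω T u g) {B : ℝ → ℝ} (hB : ContDiff ℝ (⊤ : ℕ∞) B) {a b : ℝ} (ha : 0 < a)
    (hb : b < T) (hBs : ∀ t, t ∉ Icc a b → B t = 0) :
    ∀ᵐ x ∂(volume.restrict Ω),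
      ∫ t in Ioo 0 T, (u (x, t) * deriv B t + g (x, t) * B t) = 0 := by
  have hdc : Continuous (deriv B) := hB.continuous_deriv (by simp)
  have hbdd : ∀ w : EuclideanSpace ℝ (Fin N) × ℝ → ℝ, ∀ K, IsCompact K →
      IntegrableOn w (K ×ˢ Ioo 0 T) → ∀ k : ℝ → ℝ, Continuous k →
      IntegrableOn (fun z => w z * k z.2) (K ×ˢ Ioo 0 T) := by
    intro w K hK hwK k hk
    obtain ⟨C, hC⟩ := isCompact_Icc.exists_bound_of_continuousOn (hk.continuousOn (s := Icc 0 T))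
    refine hwK.mul_bdd (c := C) (hk.comp continuous_snd).aestronglyMeasurable ?_
    filter_upwards [ae_restrict_mem (hK.measurableSet.prod measurableSet_Ioo)] with z hz
    exact hC z.2 (Ioo_subset_Icc_self hz.2)
  set W : EuclideanSpace ℝ (Fin N) × ℝ → ℝ := fun z => u z * deriv B z.2 + g z * B z.2 with hW
  have hWK : ∀ K : Set (EuclideanSpace ℝ (Fin N)), IsCompact K → K ⊆ Ω →
      IntegrableOn W (K ×ˢ Ioo 0 T) := fun K hK hKΩ =>
    (hbdd u K hK (hu K hK hKΩ) _ hdc).add (hbdd g K hK (hg K hK hKΩ) _ hB.continuous)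
  rw [ae_restrict_iff' hΩ.measurableSet]
  refine hΩ.ae_eq_zero_of_integral_contDiff_smul_eq_zero
    (f := fun x => ∫ t in Ioo 0 T, W (x, t)) ?_ ?_
  · rw [locallyIntegrableOn_iff hΩ.isLocallyClosed]
    intro K hKΩ hK
    have h1 := hWK K hK hKΩ
    rw [IntegrableOn, Measure.volume_eq_prod, ← Measure.prod_restrict] at h1
    exact h1.integral_prod_left
  · intro α hα hαc hαs
    have hzero : ∀ x, x ∉ Ω → α x = 0 := fun x hx =>
      image_eq_zero_of_notMem_tsupport fun h => hx (hαs h)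
    have h1 : ∫ x, α x • ∫ t in Ioo 0 T, W (x, t) =
        ∫ x in Ω, ∫ t in Ioo 0 T, W (x, t) * (α x * 1) := by
      rw [← setIntegral_eq_integral_of_forall_compl_eq_zero (s := Ω)
        (fun x hx => by rw [hzero x hx, zero_smul])]
      congr 1
      ext x
      rw [integral_mul_const, smul_eq_mul]
      ring
    have hi : IntegrableOn (fun z : EuclideanSpace ℝ (Fin N) × ℝ => W z * (α z.1 * 1))
        (Ω ×ˢ Ioo 0 T) :=
      integrableOn_mul_test hΩ hWK hα.continuous hαc hαs (k := fun _ => 1) continuous_const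
    have h2 : ∫ x in Ω, ∫ t in Ioo 0 T, W (x, t) * (α x * 1) =
        ∫ z in Ω ×ˢ Ioo 0 T, W z * (α z.1 * 1) :=
      (setIntegral_prod _ hi).symm
    have hψ := hw (fun z => α z.1 * B z.2) ((hα.comp contDiff_fst).mul (hB.comp contDiff_snd))
    have hsub : tsupport (fun z : EuclideanSpace ℝ (Fin N) × ℝ => α z.1 * B z.2) ⊆
        tsupport α ×ˢ Icc a b := by
      refine closure_minimal ?_ ((isClosed_tsupport α).prod isClosed_Icc)
      intro z hz
      refine ⟨?_, ?_⟩
      · by_contra h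
        exact hz (by simp [image_eq_zero_of_notMem_tsupport h])
      · by_contra h
        exact hz (by simp [hBs _ h])
    have hψ' := hψ
      (HasCompactSupport.of_support_subset_isCompact (IsCompact.prod hαc isCompact_Icc)
        ((subset_tsupport _).trans hsub))
      (hsub.trans (prod_mono hαs fun t ht => ⟨ha.trans_le ht.1, ht.2.trans_lt hb⟩))
    have hderiv : ∀ z : EuclideanSpace ℝ (Fin N) × ℝ,
        deriv (fun s => α z.1 * B s) z.2 = α z.1 * deriv B z.2 := fun z =>
      deriv_const_mul _ (hB.differentiable (by simp) _)
    simp only [hderiv] at hψ'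
    rw [h1, h2]
    have h3 : ∀ z : EuclideanSpace ℝ (Fin N) × ℝ, W z * (α z.1 * 1) =
        u z * (α z.1 * deriv B z.2) + g z * (α z.1 * B z.2) := fun z => by
      simp only [hW]; ring
    simp_rw [h3]
    rw [integral_add (integrableOn_mul_test hΩ hu hα.continuous hαc hαs hdc)
      (integrableOn_mul_test hΩ hg hα.continuous hαc hαs hB.continuous), hψ']
    ring

/-- A function with a weak time derivative is, up to a function of `x`, the primitive in time of
its derivative. -/
theorem exists_ae_eq_add_timePrimitive (hΩ : IsOpen Ω) (hT : 0 < T)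
    {u g : EuclideanSpace ℝ (Fin N) × ℝ → ℝ}
    (hum : StronglyMeasurable u) (hgm : StronglyMeasurable g)
    (hu : ∀ K : Set (EuclideanSpace ℝ (Fin N)), IsCompact K → K ⊆ Ω →
      IntegrableOn u (K ×ˢ Ioo 0 T))
    (hg : ∀ K : Set (EuclideanSpace ℝ (Fin N)), IsCompact K → K ⊆ Ω →
      IntegrableOn g (K ×ˢ Ioo 0 T))
    (hux : ∀ᵐ x ∂(volume.restrict Ω), IntegrableOn (fun t => u (x, t)) (Ioo 0 T))
    (hgx : ∀ᵐ x ∂(volume.restrict Ω), IntegrableOn (fun t => g (x, t)) (Ioo 0 T))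
    (hw : IsWeakTimeDeriv Ω T u g) :
    ∃ c : EuclideanSpace ℝ (Fin N) → ℝ, StronglyMeasurable c ∧
      ∀ᵐ z ∂((volume.restrict Ω).prod (volume.restrict (Ioo 0 T))),
        u z = c z.1 + timePrimitive T g z.1 z.2 := by
  -- Any normalised bump compactly supported in `(0, T)` would do; this one lives on `[T/4, 3T/4]`.
  let f : ContDiffBump (T / 2) := ⟨T / 8, T / 4, by positivity, by linarith⟩
  set ρ : ℝ → ℝ := f.normed volume with hρdef
  have hρ : ContDiff ℝ (⊤ : ℕ∞) ρ := f.contDiff_normed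
  have hρs : ∀ t, t ∉ Icc (T / 4) (3 * T / 4) → ρ t = 0 := by
    intro t ht
    refine image_eq_zero_of_notMem_tsupport fun h => ht ?_
    rw [hρdef, f.tsupport_normed_eq, Real.closedBall_eq_Icc] at h
    have h1 : T / 2 - T / 4 ≤ t := h.1
    have h2 : t ≤ T / 2 + T / 4 := h.2
    constructor <;> linarith
  have hρ1 : ∫ s in (0 : ℝ)..T, ρ s = 1 := by
    rw [intervalIntegral.integral_eq_integral_of_support_subset, f.integral_normed]
    intro t ht
    by_contra h
    refine ht (hρs t fun h' => h ⟨?_, ?_⟩)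
    · linarith [h'.1]
    · linarith [h'.2]
  have hIm := stronglyMeasurable_timePrimitive T hgm
  set c : EuclideanSpace ℝ (Fin N) → ℝ := fun x =>
    ∫ s in Ioo 0 T, (u (x, s) - timePrimitive T g x s) * ρ s with hc
  have hcm : StronglyMeasurable c := by
    refine StronglyMeasurable.integral_prod_right'
      (f := fun z : EuclideanSpace ℝ (Fin N) × ℝ => (u z - timePrimitive T g z.1 z.2) * ρ z.2) ?_
    exact (hum.sub hIm).mul (hρ.continuous.stronglyMeasurable.comp_measurable measurable_snd)
  refine ⟨c, hcm, ?_⟩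
  have hall : ∀ᵐ x ∂(volume.restrict Ω), ∀ q r : ℚ, (0 : ℝ) < q → (q : ℝ) < r → (r : ℝ) < T →
      ∀ n : ℕ, ∫ t in Ioo 0 T, (u (x, t) * deriv (cutoffPrimitive T ρ q r n) t +
        g (x, t) * cutoffPrimitive T ρ q r n t) = 0 := by
    rw [ae_all_iff]; intro q
    rw [ae_all_iff]; intro r
    by_cases hq : (0 : ℝ) < q
    swap
    · exact Eventually.of_forall fun _ h => absurd h hq
    by_cases hqr : (q : ℝ) < r
    swap
    · exact Eventually.of_forall fun _ _ h => absurd h hqr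
    by_cases hr : (r : ℝ) < T
    swap
    · exact Eventually.of_forall fun _ _ _ h => absurd h hr
    have : ∀ᵐ x ∂(volume.restrict Ω), ∀ n : ℕ,
        ∫ t in Ioo 0 T, (u (x, t) * deriv (cutoffPrimitive T ρ q r n) t +
        g (x, t) * cutoffPrimitive T ρ q r n t) = 0 := by
      rw [ae_all_iff]; intro n
      -- The window is the smallest interval containing both `[T/4, 3T/4]` and `[q, r]`; it stays
      -- away from `0` and `T`.
      refine ae_integral_weak_eq_zero hΩ hu hg hw (contDiff_cutoffPrimitive hρ T q r n)
        (a := min (T / 4) q) (b := max (3 * T / 4) r) (lt_min (by linarith) hq)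
        (max_lt (by linarith) hr) ?_
      intro t ht
      exact cutoffPrimitive_eq_zero hρ.continuous n (le_min (by linarith) hq.le)
        (max_le (by linarith) hr.le) hρ1
        (fun s hs => hρs s fun h => hs ⟨(min_le_left _ _).trans h.1, h.2.trans (le_max_left _ _)⟩)
        (min_le_right _ _) (le_max_right _ _) ht
    filter_upwards [this] with x hx _ _ _ using hx
  have hmeas : MeasurableSet {z : EuclideanSpace ℝ (Fin N) × ℝ |
      u z = c z.1 + timePrimitive T g z.1 z.2} :=
    measurableSet_eq_fun hum.measurable
      ((hcm.measurable.comp measurable_fst).add hIm.measurable)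
  rw [Measure.ae_prod_iff_ae_ae hmeas]
  filter_upwards [hall, hux, hgx] with x h1 h2 h3
  have h4 := ae_sub_integral_eq_const hT (v := fun t => u (x, t)) (g := timeTrunc T g x) hρ
    (a := T / 4) (b := 3 * T / 4)
    (by linarith) (by linarith) hρ1 hρs h2 (integrable_timeTrunc.2 h3) (by
      intro q r hq hqr hr n
      refine Eq.trans ?_ (h1 q r hq hqr hr n)
      refine setIntegral_congr_fun measurableSet_Ioo fun t ht => ?_
      simp only [timeTrunc, indicator_of_mem ht])
  filter_upwards [h4] with t ht
  have h5 : u (x, t) - timePrimitive T g x t = c x := ht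
  linarith

end Representation

/-! ### Young's inequality, continuity of the pairing, and the pointwise chain rule. -/

section Tools

variable {α : Type*} [MeasurableSpace α] {μ : Measure α}

/-- The modular density `|f(x)| ^ p(x)`. -/
noncomputable def density (p : Exponent μ) (f : α → ℝ) (x : α) : ℝ :=
  |f x| ^ (p.toFun x).toReal

theorem density_nonneg (p : Exponent μ) (f : α → ℝ) (x : α) : 0 ≤ density p f x :=
  Real.rpow_nonneg (abs_nonneg _) _

theorem ofReal_density (p : Exponent μ) (f : α → ℝ) (x : α) :
    ENNReal.ofReal (density p f x) = ‖f x‖ₑ ^ (p.toFun x).toReal := by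
  rw [density, ← ENNReal.ofReal_rpow_of_nonneg (abs_nonneg _) ENNReal.toReal_nonneg,
    Real.enorm_eq_ofReal_abs]

theorem lintegral_ofReal_density (p : Exponent μ) (f : α → ℝ) :
    ∫⁻ x, ENNReal.ofReal (density p f x) ∂μ = modular p f := by
  simp_rw [ofReal_density]
  rfl

theorem aestronglyMeasurable_density (p : Exponent μ) {f : α → ℝ}
    (hf : AEStronglyMeasurable f μ) : AEStronglyMeasurable (density p f) μ :=
  ((hf.aemeasurable.norm).pow p.aemeasurable.ennreal_toReal).aestronglyMeasurable

theorem integrable_density (p : Exponent μ) {f : α → ℝ} (hf : AEStronglyMeasurable f μ)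
    (h : modular p f < ∞) : Integrable (density p f) μ := by
  refine ⟨aestronglyMeasurable_density p hf, ?_⟩
  rw [hasFiniteIntegral_iff_ofReal (Eventually.of_forall (density_nonneg p f)),
    lintegral_ofReal_density]
  exact h

theorem modular_lt_top_of_integrable (p : Exponent μ) {f : α → ℝ}
    (h : Integrable (density p f) μ) : modular p f < ∞ := by
  rw [← lintegral_ofReal_density]
  exact h.lintegral_lt_top

theorem abs_le_one_add_rpow (a : ℝ) {q : ℝ} (hq : 1 ≤ q) : |a| ≤ 1 + |a| ^ q := by
  have h := Real.rpow_nonneg (abs_nonneg a) q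
  rcases le_total |a| 1 with h1 | h1
  · linarith
  · have := Real.rpow_le_rpow_of_exponent_le h1 hq
    rw [Real.rpow_one] at this
    linarith

/-- Young's inequality with the factors `1/p'` and `1/p` discarded. The quantifiers over `a`, `b`
stand inside the almost-everywhere statement so that values taken at different times can be inserted
at the same `x`. -/
theorem ae_abs_mul_le (p : Exponent μ) : ∀ᵐ x ∂μ, ∀ a b : ℝ,
    |a * b| ≤ |a| ^ (p.conj.toFun x).toReal + |b| ^ (p.toFun x).toReal := by
  filter_upwards [p.ae_one_lt, p.ae_lt_top, p.ae_one_le_toReal, p.conj.ae_one_le_toReal]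
    with x h1 h2 h3 h4 a b
  have hh : (p.conj.toFun x).HolderConjugate (p.toFun x) := by
    have : (p.toFun x).HolderConjugate (p.conj.toFun x) := .conjExponent h1.le
    exact this.symm
  have hr : (p.conj.toFun x).toReal.HolderConjugate (p.toFun x).toReal := by
    have := ENNReal.HolderTriple.toReal (p := p.conj.toFun x) (q := p.toFun x) 1
      (by linarith) (by linarith)
    simpa using this
  rw [abs_mul]
  refine (Real.young_inequality_of_nonneg (abs_nonneg a) (abs_nonneg b) hr).trans ?_
  exact add_le_add (div_le_self (Real.rpow_nonneg (abs_nonneg _) _) h4)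
    (div_le_self (Real.rpow_nonneg (abs_nonneg _) _) h3)

theorem LpVar.coeFn_sub {p : Exponent μ} (f g : LpVar p) :
    ((f - g : LpVar p) : α → ℝ) =ᵐ[μ] fun x => f x - g x :=
  AEEqFun.coeFn_sub f.toAEEqFun g.toAEEqFun

theorem pairing_add {p : Exponent μ} (η : LpVar p.conj) (v w : LpVar p) :
    pairing η (v + w) = pairing η v + pairing η w := by
  unfold pairing
  rw [← integral_add (integrable_pairing η v) (integrable_pairing η w)]
  refine integral_congr_ae ?_
  filter_upwards [LpVar.coeFn_add v w] with x hx
  rw [hx, mul_add]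

theorem pairing_smul {p : Exponent μ} (η : LpVar p.conj) (c : ℝ) (v : LpVar p) :
    pairing η (c • v) = c * pairing η v := by
  unfold pairing
  rw [← integral_const_mul]
  refine integral_congr_ae ?_
  filter_upwards [LpVar.coeFn_smul c v] with x hx
  rw [hx]
  ring

/-- Young's inequality for `η` and `v / r`, with `r` admissible in the Luxemburg norm, followed by
the infimum over `r`. The constant is not sharp, but continuity is all that is needed. -/
theorem abs_pairing_le {p : Exponent μ} (η : LpVar p.conj) (v : LpVar p) :
    |pairing η v| ≤ ((∫ x, density p.conj η x ∂μ) + 1) * ‖v‖ := by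
  have hη0 : 0 ≤ ∫ x, density p.conj η x ∂μ := integral_nonneg (density_nonneg _ _)
  have hη := integrable_density p.conj η.aestronglyMeasurable η.modular_lt_top
  rw [← div_le_iff₀' (by linarith)]
  rw [LpVar.norm_def]
  refine le_csInf (LpVar.normSet_nonempty v) fun r hr => ?_
  rw [div_le_iff₀' (by linarith)]
  have hr0 := hr.1
  have hvm : AEStronglyMeasurable (fun x => v x / r) μ := by
    simp_rw [div_eq_inv_mul]
    exact v.aestronglyMeasurable.const_mul _
  have hvi := integrable_density p hvm (hr.2.trans_lt ENNReal.one_lt_top)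
  have hv1 : ∫ x, density p (fun x => v x / r) x ∂μ ≤ 1 := by
    rw [integral_eq_lintegral_of_nonneg_ae (Eventually.of_forall (density_nonneg _ _)) hvi.1,
      lintegral_ofReal_density]
    exact ENNReal.toReal_le_of_le_ofReal zero_le_one (by simpa using hr.2)
  have h1 : |pairing η v| ≤ ∫ x, r * (density p.conj η x + density p (fun x => v x / r) x) ∂μ := by
    rw [pairing, ← Real.norm_eq_abs]
    refine norm_integral_le_of_norm_le ((hη.add hvi).const_mul r) ?_
    filter_upwards [ae_abs_mul_le p] with x hx
    have h2 := hx (η x) (v x / r)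
    have h3 : η x * v x = r * (η x * (v x / r)) := by field_simp
    rw [h3, Real.norm_eq_abs, abs_mul, abs_of_pos hr0]
    exact mul_le_mul_of_nonneg_left h2 hr0.le
  rw [integral_const_mul, integral_add hη hvi] at h1
  refine h1.trans ?_
  rw [mul_comm]
  gcongr

/-- The functional `⟨η, ·⟩` as a continuous linear map. -/
noncomputable def pairingCLM {p : Exponent μ} (η : LpVar p.conj) : LpVar p →L[ℝ] ℝ :=
  LinearMap.mkContinuous
    { toFun := pairing η
      map_add' := pairing_add η
      map_smul' := pairing_smul η }
    ((∫ x, density p.conj η x ∂μ) + 1) (abs_pairing_le η)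

theorem pairingCLM_apply {p : Exponent μ} (η : LpVar p.conj) (v : LpVar p) :
    pairingCLM η v = pairing η v := rfl

/-- At a common point of differentiability the derivative of a convex functional along a curve is
given by any subgradient. -/
theorem deriv_eq_pairing {p : Exponent μ} {F : LpVar p → EReal} {U : ℝ → LpVar p} {t : ℝ}
    (hfin : ∀ᶠ s in 𝓝 t, F (U s) ≠ ⊤ ∧ F (U s) ≠ ⊥) (hU : DifferentiableAt ℝ U t)
    (hF : DifferentiableAt ℝ (fun s => (F (U s)).toReal) t) {η : LpVar p.conj}
    (hη : η ∈ subdifferential F (U t)) :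
    deriv (fun s => (F (U s)).toReal) t = pairing η (deriv U t) := by
  have h1 : HasDerivAt (fun s => pairingCLM η (U s)) (pairingCLM η (deriv U t)) t :=
    (pairingCLM η).hasFDerivAt.comp_hasDerivAt t hU.hasDerivAt
  have h2 := hF.hasDerivAt.sub h1
  -- The subgradient inequality at `U t`, restricted to the curve, says precisely this.
  have h3 : IsLocalMin (fun s => (F (U s)).toReal - pairingCLM η (U s)) t := by
    filter_upwards [hfin] with s hs
    have ht := hfin.self_of_nhds
    have h4 := hη.2 (U s)
    rw [← EReal.coe_toReal hs.1 hs.2, ← EReal.coe_toReal ht.1 ht.2, ← EReal.coe_add,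
      EReal.coe_le_coe_iff] at h4
    have h5 : pairing η (U s - U t) = pairingCLM η (U s) - pairingCLM η (U t) :=
      (pairingCLM η).map_sub (U s) (U t)
    linarith
  have h6 := h3.hasDerivAt_eq_zero h2
  rw [pairingCLM_apply] at h6
  linarith

theorem timeEval_eq {p : Exponent μ} {T : ℝ} {u : LpVar (p.cyl T)} {v : LpVar p} {t : ℝ}
    (h : (v : α → ℝ) =ᵐ[μ] fun x => u (x, t)) : timeEval u t = v := by
  have h1 : AEStronglyMeasurable (fun x => u (x, t)) μ := v.aestronglyMeasurable.congr h
  have h2 : modular p (fun x => u (x, t)) < ∞ := by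
    rw [← modular_congr p h]
    exact v.modular_lt_top
  rw [timeEval, dif_pos ⟨h1, h2⟩]
  exact LpVar.ext ((LpVar.coeFn_mk _ _ _).trans h.symm)

theorem LpVar.stronglyMeasurable {p : Exponent μ} (f : LpVar p) : StronglyMeasurable (f : α → ℝ) :=
  AEEqFun.stronglyMeasurable _

theorem LpVar.integrable_density {p : Exponent μ} (f : LpVar p) : Integrable (density p f) μ :=
  VarLebesgue.integrable_density p f.aestronglyMeasurable f.modular_lt_top

end Tools

/-! ### Time sections of functions on the cylinder and the absolutely continuous representative. -/

section TimeDependent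

variable {α : Type*} [MeasurableSpace α] {μ : Measure α} [SFinite μ] {p : Exponent μ} {T : ℝ}

theorem ae_integrable_density_section_right (w : LpVar (p.cyl T)) :
    ∀ᵐ t ∂(volume.restrict (Ioo 0 T)), Integrable (density p fun x => w (x, t)) μ :=
  w.integrable_density.prod_left_ae

theorem ae_integrable_density_section_left (w : LpVar (p.cyl T)) :
    ∀ᵐ x ∂μ, IntegrableOn (fun t => density (p.cyl T) w (x, t)) (Ioo 0 T) :=
  w.integrable_density.prod_right_ae

/-- Here `|w| ≤ 1 + |w|^p`, and the constant is integrable because the time interval is bounded. -/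
theorem ae_integrableOn_section (w : LpVar (p.cyl T)) :
    ∀ᵐ x ∂μ, IntegrableOn (fun t => w (x, t)) (Ioo 0 T) := by
  filter_upwards [ae_integrable_density_section_left w, p.ae_one_le_toReal] with x h1 h2
  have h3 : IntegrableOn (fun _ => (1 : ℝ)) (Ioo 0 T) := integrableOn_const (by simp)
  refine (h3.add h1).mono'
    (w.stronglyMeasurable.comp_measurable measurable_prodMk_left).aestronglyMeasurable ?_
  exact Eventually.of_forall fun t => abs_le_one_add_rpow _ h2

/-- By Fubini almost every section has finite modular, so the default value `0` of `timeEval` occurs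
only on a null set of times. -/
theorem ae_coeFn_timeEval (u : LpVar (p.cyl T)) :
    ∀ᵐ t ∂(volume.restrict (Ioo 0 T)), (timeEval u t : α → ℝ) =ᵐ[μ] fun x => u (x, t) := by
  filter_upwards [ae_integrable_density_section_right u] with t ht
  have h1 : AEStronglyMeasurable (fun x => u (x, t)) μ :=
    (u.stronglyMeasurable.comp_measurable measurable_prodMk_right).aestronglyMeasurable
  rw [timeEval, dif_pos ⟨h1, modular_lt_top_of_integrable p ht⟩]
  exact LpVar.coeFn_mk _ _ _

theorem integrable_timeTrunc_prod {D : α × ℝ → ℝ}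
    (hD : Integrable D (μ.prod (volume.restrict (Ioo 0 T)))) :
    Integrable (fun z : α × ℝ => timeTrunc T D z.1 z.2) (μ.prod volume) := by
  have h1 : (fun z : α × ℝ => timeTrunc T D z.1 z.2) = (univ ×ˢ Ioo 0 T).indicator D := by
    ext z
    by_cases hz : z.2 ∈ Ioo 0 T
    · rw [timeTrunc, indicator_of_mem hz, indicator_of_mem (by simpa using hz)]
    · rw [timeTrunc, indicator_of_notMem hz, indicator_of_notMem (by simpa using hz)]
  rw [h1, integrable_indicator_iff (MeasurableSet.univ.prod measurableSet_Ioo), IntegrableOn,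
    ← Measure.prod_restrict, Measure.restrict_univ]
  exact hD

/-- Jensen's inequality on an interval. -/
theorem rpow_abs_integral_le {f : ℝ → ℝ} {q s t : ℝ} (hq : 1 ≤ q) (hst : s < t)
    (hf : IntervalIntegrable f volume s t)
    (hfq : IntervalIntegrable (fun τ => |f τ| ^ q) volume s t) :
    |(t - s)⁻¹ * ∫ τ in s..t, f τ| ^ q ≤ (t - s)⁻¹ * ∫ τ in s..t, |f τ| ^ q := by
  have hd : 0 < t - s := by linarith
  have h1 : |(t - s)⁻¹ * ∫ τ in s..t, f τ| ≤ (t - s)⁻¹ * ∫ τ in s..t, |f τ| := by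
    rw [abs_mul, abs_of_pos (inv_pos.2 hd)]
    gcongr
    exact intervalIntegral.abs_integral_le_integral_abs hst.le
  refine (Real.rpow_le_rpow (abs_nonneg _) h1 (by linarith)).trans ?_
  have h2 := (convexOn_rpow hq).map_set_average_le (μ := volume) (t := Ioc s t)
    (f := fun τ => |f τ|) (Real.continuous_rpow_const (by linarith)).continuousOn isClosed_Ici
    (by simp [hst]) (by simp)
    (Eventually.of_forall fun τ => abs_nonneg (f τ)) hf.1.abs hfq.1
  rw [setAverage_eq, setAverage_eq, Real.volume_real_Ioc_of_le hst.le,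
    ← intervalIntegral.integral_of_le hst.le, smul_eq_mul, smul_eq_mul] at h2
  rw [intervalIntegral.integral_of_le hst.le (f := fun τ => |f τ| ^ q)]
  exact h2

/-- Minkowski's inequality for time integrals. -/
theorem exists_coeFn_eq_integral (w : LpVar (p.cyl T)) {s t : ℝ} (hst : s < t) :
    ∃ f : LpVar p, ((f : α → ℝ) =ᵐ[μ] fun x => ∫ τ in s..t, timeTrunc T w x τ) ∧
      ‖f‖ ≤ ∫ τ in s..t, (1 + ∫ x, timeTrunc T (density (p.cyl T) w) x τ ∂μ) := by
  have hd : 0 < t - s := by linarith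
  set D : α × ℝ → ℝ := fun z => timeTrunc T (density (p.cyl T) w) z.1 z.2 with hD
  have hDi : Integrable D (μ.prod volume) := integrable_timeTrunc_prod w.integrable_density
  have hD0 : ∀ z, 0 ≤ D z := fun z => indicator_nonneg (fun _ _ => density_nonneg _ _ _) _
  have hDr : Integrable D (μ.prod (volume.restrict (Ioc s t))) :=
    hDi.mono_measure (Measure.prod_mono le_rfl Measure.restrict_le_self)
  set L : ℝ := ∫ τ in s..t, ∫ x, D (x, τ) ∂μ with hL
  have hL0 : 0 ≤ L := intervalIntegral.integral_nonneg hst.le fun τ _ => integral_nonneg fun x => hD0 _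
  have hLs : L = ∫ x, (∫ τ in s..t, D (x, τ)) ∂μ := by
    rw [hL]
    simp_rw [intervalIntegral.integral_of_le hst.le]
    exact (integral_integral_swap hDr).symm
  have hLi : Integrable (fun x => ∫ τ in s..t, D (x, τ)) μ := by
    simp_rw [intervalIntegral.integral_of_le hst.le]
    exact hDr.integral_prod_left
  -- This `r` is an admissible scaling: the quotient by `r` is `(t - s) / r ≤ 1` times a time
  -- average, so Jensen with the exponent `p(x)`, constant in time, bounds the modular by `L / r ≤
  -- 1`.
  set r : ℝ := (t - s) + L with hr
  have hr0 : 0 < r := by positivity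
  have hm : AEStronglyMeasurable (fun x => ∫ τ in s..t, timeTrunc T w x τ) μ := by
    simp_rw [intervalIntegral.integral_of_le hst.le]
    exact (StronglyMeasurable.integral_prod_right'
      (stronglyMeasurable_timeTrunc T w.stronglyMeasurable)).aestronglyMeasurable
  have hmod : modular p (fun x => (∫ τ in s..t, timeTrunc T w x τ) / r) ≤ 1 := by
    have h1 : modular p (fun x => (∫ τ in s..t, timeTrunc T w x τ) / r) ≤
        ∫⁻ x, ENNReal.ofReal (r⁻¹ * ∫ τ in s..t, D (x, τ)) ∂μ := by
      rw [← lintegral_ofReal_density]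
      refine lintegral_mono_ae ?_
      filter_upwards [p.ae_one_le_toReal, ae_integrableOn_section w,
        ae_integrable_density_section_left w] with x h1 h2 h3
      refine ENNReal.ofReal_le_ofReal ?_
      have hq0 : 0 < (p.toFun x).toReal := by linarith
      have hDx : ∀ τ, D (x, τ) = |timeTrunc T w x τ| ^ (p.toFun x).toReal := by
        intro τ
        simp only [hD, timeTrunc]
        by_cases hτ : τ ∈ Ioo 0 T
        · rw [indicator_of_mem hτ, indicator_of_mem hτ]
          rfl
        · rw [indicator_of_notMem hτ, indicator_of_notMem hτ, abs_zero, Real.zero_rpow hq0.ne']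
      have hDxi : Integrable fun τ => D (x, τ) := integrable_timeTrunc.2 h3
      have hJ := rpow_abs_integral_le h1 hst
        (integrable_timeTrunc.2 h2).intervalIntegrable
        (by simpa only [hDx] using hDxi.intervalIntegrable (a := s) (b := t))
      simp_rw [hDx]
      change |(∫ τ in s..t, timeTrunc T w x τ) / r| ^ (p.toFun x).toReal ≤ _
      have h4 : (∫ τ in s..t, timeTrunc T w x τ) / r =
          ((t - s) / r) * ((t - s)⁻¹ * ∫ τ in s..t, timeTrunc T w x τ) := by
        field_simp
      have h5 : 0 ≤ (t - s) / r := by positivity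
      have h6 : (t - s) / r ≤ 1 := by
        rw [div_le_one hr0]
        linarith
      have h7 : ((t - s) / r) ^ (p.toFun x).toReal ≤ (t - s) / r := by
        have := Real.rpow_le_rpow_of_exponent_ge' h5 h6 zero_le_one h1
        rwa [Real.rpow_one] at this
      rw [h4, abs_mul, abs_of_nonneg h5, Real.mul_rpow h5 (abs_nonneg _)]
      refine (mul_le_mul h7 hJ (Real.rpow_nonneg (abs_nonneg _) _) h5).trans (le_of_eq ?_)
      field_simp
    refine h1.trans ?_
    rw [← ofReal_integral_eq_lintegral_ofReal (hLi.const_mul _)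
      (Eventually.of_forall fun x => mul_nonneg (inv_nonneg.2 hr0.le)
        (intervalIntegral.integral_nonneg hst.le fun τ _ => hD0 _)),
      integral_const_mul, ← hLs, ENNReal.ofReal_le_one, inv_mul_le_iff₀ hr0]
    linarith
  have hmod' : modular p (fun x => ∫ τ in s..t, timeTrunc T w x τ) < ∞ := by
    have h1 := modular_const_mul_lt_top p (hmod.trans_lt ENNReal.one_lt_top) r
    have h2 : (fun x => r * ((∫ τ in s..t, timeTrunc T w x τ) / r)) =
        fun x => ∫ τ in s..t, timeTrunc T w x τ := by
      ext x
      field_simp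
    rwa [h2] at h1
  refine ⟨LpVar.mk _ hm hmod', LpVar.coeFn_mk _ _ _, ?_⟩
  have h1 : ∫ τ in s..t, (1 + ∫ x, timeTrunc T (density (p.cyl T) w) x τ ∂μ) = r := by
    rw [intervalIntegral.integral_add (by simp)
      (hDi.integral_prod_right.intervalIntegrable (a := s) (b := t))]
    simp [hr, hL, hD]
  rw [h1]
  refine LpVar.norm_le_of_mem ⟨hr0, ?_⟩
  refine le_trans (le_of_eq (modular_congr p ?_)) hmod
  filter_upwards [LpVar.coeFn_mk _ hm hmod'] with x hx
  rw [hx]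

/-- The absolutely continuous representative of a function with a time derivative. -/
theorem exists_absolutelyContinuous_representative (hT : 0 < T) (u w : LpVar (p.cyl T)) {c : α → ℝ}
    (hrep : ∀ᵐ z ∂(μ.prod (volume.restrict (Ioo 0 T))),
      u z = c z.1 + timePrimitive T w z.1 z.2) :
    ∃ U : ℝ → LpVar p, (∀ t, (U t : α → ℝ) =ᵐ[μ] fun x => c x + timePrimitive T w x t) ∧
      AbsolutelyContinuousOnInterval U 0 T ∧
      ∀ᵐ t ∂(volume.restrict (Ioo 0 T)), U t = timeEval u t := by
  have hswap : ∀ᵐ t ∂(volume.restrict (Ioo 0 T)), ∀ᵐ x ∂μ,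
      u (x, t) = c x + timePrimitive T w x t := by
    have h1 := (Measure.measurePreserving_swap (μ := volume.restrict (Ioo 0 T))
      (ν := μ)).quasiMeasurePreserving.ae hrep
    exact Measure.ae_ae_of_ae_prod h1
  have hne : (ae (volume.restrict (Ioo 0 T))).NeBot := by
    rw [ae_neBot]
    intro h
    rw [Measure.restrict_eq_zero, Real.volume_Ioo] at h
    simp at h
    linarith
  -- The function `c` is not assumed to lie in the space; the state at one good time `t₀` does, and
  -- every other state is reached from it by adding or subtracting a time integral of `w`.
  obtain ⟨t₀, ht₀, ht₀'⟩ := (hswap.and (ae_coeFn_timeEval u)).exists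
  have hint := ae_integrableOn_section w
  have hex : ∀ t, ∃ v : LpVar p, (v : α → ℝ) =ᵐ[μ] fun x => c x + timePrimitive T w x t := by
    intro t
    rcases lt_trichotomy t t₀ with h | h | h
    · obtain ⟨f, hf, -⟩ := exists_coeFn_eq_integral w h
      refine ⟨timeEval u t₀ - f, ?_⟩
      filter_upwards [LpVar.coeFn_sub (timeEval u t₀) f, ht₀, ht₀', hf, hint] with x h1 h2 h3 h4 h5
      have h6 := timePrimitive_sub (integrable_timeTrunc.2 h5) t t₀
      rw [h1, h3, h2, h4, ← h6]
      ring
    · refine ⟨timeEval u t₀, ?_⟩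
      filter_upwards [ht₀, ht₀'] with x h2 h3
      rw [h3, h2, h]
    · obtain ⟨f, hf, -⟩ := exists_coeFn_eq_integral w h
      refine ⟨timeEval u t₀ + f, ?_⟩
      filter_upwards [LpVar.coeFn_add (timeEval u t₀) f, ht₀, ht₀', hf, hint] with x h1 h2 h3 h4 h5
      have h6 := timePrimitive_sub (integrable_timeTrunc.2 h5) t₀ t
      rw [h1, h3, h2, h4, ← h6]
      ring
  choose U hU using hex
  refine ⟨U, hU, ?_, ?_⟩
  · set k : ℝ → ℝ := fun τ => 1 + ∫ x, timeTrunc T (density (p.cyl T) w) x τ ∂μ with hk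
    have hki : ∀ a b, IntervalIntegrable k volume a b := fun a b =>
      (by simp : IntervalIntegrable (fun _ => (1 : ℝ)) volume a b).add
        (integrable_timeTrunc_prod w.integrable_density).integral_prod_right.intervalIntegrable
    have hlt : ∀ s t, s < t → dist (U s) (U t) ≤ |∫ τ in s..t, k τ| := by
      intro s t hst
      obtain ⟨f, hf, hfn⟩ := exists_coeFn_eq_integral w hst
      have : U t - U s = f := by
        refine LpVar.ext ?_
        filter_upwards [LpVar.coeFn_sub (U t) (U s), hU t, hU s, hf, hint] with x h1 h2 h3 h4 h5
        have h6 := timePrimitive_sub (integrable_timeTrunc.2 h5) s t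
        rw [h1, h2, h3, h4, ← h6]
        ring
      rw [dist_comm, dist_eq_norm, this]
      exact hfn.trans (le_abs_self _)
    refine absolutelyContinuousOnInterval_of_dist_le
      ((hki 0 T).absolutelyContinuousOnInterval_intervalIntegral (c := 0) (by simp))
      fun s _ t _ => ?_
    rw [Real.dist_eq, intervalIntegral.integral_interval_sub_left (hki _ _) (hki _ _)]
    rcases lt_trichotomy s t with h | h | h
    · rw [intervalIntegral.integral_symm, abs_neg]
      exact hlt s t h
    · simp [h]
    · rw [dist_comm]
      exact hlt t s h
  · filter_upwards [hswap] with t ht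
    exact (timeEval_eq ((hU t).trans (ht.mono fun x hx => hx.symm))).symm

end TimeDependent

/-! ### Localising the subgradient inequality and testing it with translations. -/

section Subgradient

variable {α : Type*} [MeasurableSpace α] {μ : Measure α} {p : Exponent μ} {T : ℝ}

theorem finite_and_integrable_of_Phi_lt_top {φ : LpVar p → EReal} {u : LpVar (p.cyl T)}
    (h : Phi φ u < ⊤) : (∀ᵐ t ∂(volume.restrict (Ioo 0 T)), φ (timeEval u t) < ⊤) ∧
      IntegrableOn (fun t => (φ (timeEval u t)).toReal) (Ioo 0 T) := by
  rw [Phi] at h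
  split_ifs at h with h1
  · exact h1
  · exact absurd h (lt_irrefl _)

theorem Phi_eq_integral {φ : LpVar p → EReal} {u : LpVar (p.cyl T)}
    (h1 : ∀ᵐ t ∂(volume.restrict (Ioo 0 T)), φ (timeEval u t) < ⊤)
    (h2 : IntegrableOn (fun t => (φ (timeEval u t)).toReal) (Ioo 0 T)) :
    Phi φ u = ((∫ t in Ioo 0 T, (φ (timeEval u t)).toReal : ℝ) : EReal) := by
  rw [Phi, if_pos ⟨h1, h2⟩]

/-- The two times are independent, which is possible because the exponent depends on `x` alone. This
separated bound replaces Hölder's inequality in the passage to the limit. -/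
theorem ae_abs_timeTrunc_mul_le (T : ℝ) (ξ w : α × ℝ → ℝ) :
    ∀ᵐ x ∂μ, ∀ s t : ℝ, |timeTrunc T ξ x s * timeTrunc T w x t| ≤
      timeTrunc T (density (p.cyl T).conj ξ) x s + timeTrunc T (density (p.cyl T) w) x t := by
  filter_upwards [ae_abs_mul_le p] with x hx s t
  have hA : 0 ≤ timeTrunc T (density (p.cyl T).conj ξ) x s :=
    indicator_nonneg (fun _ _ => density_nonneg _ _ _) _
  have hB : 0 ≤ timeTrunc T (density (p.cyl T) w) x t :=
    indicator_nonneg (fun _ _ => density_nonneg _ _ _) _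
  by_cases hs : s ∈ Ioo 0 T
  · by_cases ht : t ∈ Ioo 0 T
    · simp only [timeTrunc, indicator_of_mem hs, indicator_of_mem ht]
      exact hx _ _
    · have : timeTrunc T w x t = 0 := indicator_of_notMem ht _
      rw [this, mul_zero, abs_zero]
      linarith
  · have : timeTrunc T ξ x s = 0 := indicator_of_notMem hs _
    rw [this, zero_mul, abs_zero]
    linarith

variable [SFinite μ]

theorem prod_restrict_univ_prod {E : Set ℝ} (hET : E ⊆ Ioo 0 T) :
    (μ.prod (volume.restrict (Ioo 0 T))).restrict (univ ×ˢ E) = μ.prod (volume.restrict E) := by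
  rw [← Measure.prod_restrict, Measure.restrict_univ, Measure.restrict_restrict_of_subset hET]

open Classical in
/-- The subgradient inequality on the cylinder, localised to a set of times. -/
theorem integral_mul_sub_le_of_mem_subdifferential {φ : LpVar p → EReal}
    {u : LpVar (p.cyl T)} {ξ : LpVar (p.cyl T).conj} (hξ : ξ ∈ subdifferential (Phi φ) u)
    {E : Set ℝ} (hE : MeasurableSet E) (hET : E ⊆ Ioo 0 T) {w : α × ℝ → ℝ}
    (hwm : StronglyMeasurable w)
    (hwi : Integrable (density (p.cyl T) w) (μ.prod (volume.restrict E))) {v : ℝ → LpVar p}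
    (hv : ∀ᵐ t ∂(volume.restrict E), (v t : α → ℝ) =ᵐ[μ] fun x => w (x, t))
    (hφv : ∀ᵐ t ∂(volume.restrict E), φ (v t) < ⊤)
    (hφi : IntegrableOn (fun t => (φ (v t)).toReal) E) :
    Integrable (fun z => ξ z * (w z - u z)) (μ.prod (volume.restrict E)) ∧
    ∫ z, ξ z * (w z - u z) ∂(μ.prod (volume.restrict E)) ≤
      (∫ t in E, (φ (v t)).toReal) - ∫ t in E, (φ (timeEval u t)).toReal := by
  obtain ⟨hu1, hu2⟩ := finite_and_integrable_of_Phi_lt_top hξ.1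
  have hEm : MeasurableSet ((univ : Set α) ×ˢ E) := MeasurableSet.univ.prod hE
  -- The competitor follows `w` during `E` and `u` at all other times, so the contributions from
  -- outside `E` cancel.
  set F : α × ℝ → ℝ := fun z => if z.2 ∈ E then w z else u z with hF
  have hFm : StronglyMeasurable F := StronglyMeasurable.ite (measurable_snd hE) hwm u.stronglyMeasurable
  have hwi' : Integrable (((univ : Set α) ×ˢ E).indicator (density (p.cyl T) w))
      (μ.prod (volume.restrict (Ioo 0 T))) := by
    rw [integrable_indicator_iff hEm, IntegrableOn, prod_restrict_univ_prod hET]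
    exact hwi
  have hFd : Integrable (density (p.cyl T) F) (μ.prod (volume.restrict (Ioo 0 T))) := by
    refine (hwi'.add u.integrable_density).mono'
      (aestronglyMeasurable_density _ hFm.aestronglyMeasurable) (Eventually.of_forall fun z => ?_)
    rw [Real.norm_of_nonneg (density_nonneg _ _ _), Pi.add_apply]
    by_cases hz : z.2 ∈ E
    · rw [indicator_of_mem (by simpa using hz)]
      have : density (p.cyl T) F z = density (p.cyl T) w z := by simp [density, hF, hz]
      rw [this]
      linarith [density_nonneg (p.cyl T) u z]
    · rw [indicator_of_notMem (by simpa using hz)]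
      have : density (p.cyl T) F z = density (p.cyl T) u z := by simp [density, hF, hz]
      rw [this, zero_add]
  set W : LpVar (p.cyl T) := LpVar.mk F hFm.aestronglyMeasurable
    (modular_lt_top_of_integrable _ hFd) with hW
  have hWF : (W : α × ℝ → ℝ) =ᵐ[μ.prod (volume.restrict (Ioo 0 T))] F := LpVar.coeFn_mk _ _ _
  have hswap : ∀ᵐ t ∂(volume.restrict (Ioo 0 T)), ∀ᵐ x ∂μ, W (x, t) = F (x, t) :=
    Measure.ae_ae_of_ae_prod ((Measure.measurePreserving_swap (μ := volume.restrict (Ioo 0 T))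
      (ν := μ)).quasiMeasurePreserving.ae hWF)
  have hevE : ∀ᵐ t ∂(volume.restrict E), timeEval W t = v t := by
    filter_upwards [ae_mono (Measure.restrict_mono hET le_rfl) hswap, hv, ae_restrict_mem hE]
      with t h1 h2 h3
    refine timeEval_eq ?_
    filter_upwards [h1, h2] with x h4 h5
    rw [h5, h4, hF]
    simp [h3]
  have hevEc : ∀ᵐ t ∂(volume.restrict (Ioo 0 T \ E)), timeEval W t = timeEval u t := by
    filter_upwards [ae_mono (Measure.restrict_mono sdiff_subset le_rfl) hswap,
      ae_mono (Measure.restrict_mono sdiff_subset le_rfl) (ae_coeFn_timeEval u),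
      ae_restrict_mem (measurableSet_Ioo.diff hE)] with t h1 h2 h3
    refine timeEval_eq ?_
    filter_upwards [h1, h2] with x h4 h5
    rw [h5, h4, hF]
    simp [h3.2]
  have hunion : E ∪ (Ioo 0 T \ E) = Ioo 0 T := union_sdiff_cancel hET
  have hW1 : ∀ᵐ t ∂(volume.restrict (Ioo 0 T)), φ (timeEval W t) < ⊤ := by
    rw [← hunion, ae_restrict_union_iff]
    constructor
    · filter_upwards [hevE, hφv] with t h1 h2
      rwa [h1]
    · filter_upwards [hevEc, ae_mono (Measure.restrict_mono sdiff_subset le_rfl) hu1] with t h1 h2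
      rwa [h1]
  have hWiE : IntegrableOn (fun t => (φ (timeEval W t)).toReal) E :=
    hφi.congr (hevE.mono fun t ht => by simp only [ht])
  have hWiEc : IntegrableOn (fun t => (φ (timeEval W t)).toReal) (Ioo 0 T \ E) :=
    (hu2.mono_set sdiff_subset).congr (hevEc.mono fun t ht => by simp only [ht])
  have hW2 : IntegrableOn (fun t => (φ (timeEval W t)).toReal) (Ioo 0 T) := by
    rw [← hunion]
    exact hWiE.union hWiEc
  have hineq := hξ.2 W
  rw [Phi_eq_integral hu1 hu2, Phi_eq_integral hW1 hW2, ← EReal.coe_add,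
    EReal.coe_le_coe_iff] at hineq
  have hs1 : ∫ t in Ioo 0 T, (φ (timeEval W t)).toReal =
      (∫ t in E, (φ (v t)).toReal) + ∫ t in Ioo 0 T \ E, (φ (timeEval u t)).toReal := by
    conv_lhs => rw [← hunion]
    rw [setIntegral_union disjoint_sdiff_right (measurableSet_Ioo.diff hE) hWiE hWiEc]
    congr 1
    · exact integral_congr_ae (hevE.mono fun t ht => by simp only [ht])
    · exact integral_congr_ae (hevEc.mono fun t ht => by simp only [ht])
  have hs2 : ∫ t in Ioo 0 T, (φ (timeEval u t)).toReal =
      (∫ t in E, (φ (timeEval u t)).toReal) + ∫ t in Ioo 0 T \ E, (φ (timeEval u t)).toReal := by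
    conv_lhs => rw [← hunion]
    rw [setIntegral_union disjoint_sdiff_right (measurableSet_Ioo.diff hE) (hu2.mono_set hET)
      (hu2.mono_set sdiff_subset)]
  have hpt : (fun z => ξ z * (W - u : LpVar (p.cyl T)) z) =ᵐ[μ.prod (volume.restrict (Ioo 0 T))]
      ((univ : Set α) ×ˢ E).indicator fun z => ξ z * (w z - u z) := by
    filter_upwards [hWF, LpVar.coeFn_sub W u] with z h1 h2
    rw [h2, h1, hF]
    by_cases hz : z.2 ∈ E
    · rw [indicator_of_mem (by simpa using hz)]
      simp [hz]
    · rw [indicator_of_notMem (by simpa using hz)]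
      simp [hz]
  have hint := (integrable_pairing ξ (W - u)).congr hpt
  have hpair : pairing ξ (W - u) = ∫ z, ξ z * (w z - u z) ∂(μ.prod (volume.restrict E)) := by
    rw [pairing, integral_congr_ae hpt, integral_indicator hEm, prod_restrict_univ_prod hET]
  rw [integrable_indicator_iff hEm, IntegrableOn, prod_restrict_univ_prod hET] at hint
  refine ⟨hint, ?_⟩
  rw [hpair, hs1, hs2] at hineq
  linarith

theorem ae_integrable_timeTrunc (w : LpVar (p.cyl T)) : ∀ᵐ x ∂μ, Integrable (timeTrunc T w x) :=
  (ae_integrableOn_section w).mono fun _ hx => integrable_timeTrunc.2 hx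

theorem ae_integrable_timeTrunc_density (w : LpVar (p.cyl T)) :
    ∀ᵐ x ∂μ, Integrable (timeTrunc T (density (p.cyl T) w) x) :=
  (ae_integrable_density_section_left w).mono fun _ hx => integrable_timeTrunc.2 hx

/-- The subgradient inequality tested with a translation in time. -/
theorem integral_translation_le {φ : LpVar p → EReal}
    {u w : LpVar (p.cyl T)} {c : α → ℝ}
    (hrep : ∀ᵐ z ∂(μ.prod (volume.restrict (Ioo 0 T))), u z = c z.1 + timePrimitive T w z.1 z.2)
    {ξ : LpVar (p.cyl T).conj} (hξ : ξ ∈ subdifferential (Phi φ) u) {a b h : ℝ} (hab : a ≤ b)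
    (ha : 0 ≤ a) (hb : b ≤ T) (hah : 0 ≤ a + h) (hbh : b + h ≤ T) :
    ∫ x, (∫ t in a..b, timeTrunc T ξ x t * ∫ τ in t..t + h, timeTrunc T w x τ) ∂μ ≤
      ∫ t in a..b, ((Ioo 0 T).indicator (fun t => (φ (timeEval u t)).toReal) (t + h) -
        (Ioo 0 T).indicator (fun t => (φ (timeEval u t)).toReal) t) := by
  set f : ℝ → ℝ := fun t => (φ (timeEval u t)).toReal with hf
  obtain ⟨hu1, hu2⟩ := finite_and_integrable_of_Phi_lt_top hξ.1
  set E : Set ℝ := Ioo a b with hEdef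
  have hET : E ⊆ Ioo 0 T := Ioo_subset_Ioo ha hb
  have hEh : ∀ t ∈ E, t + h ∈ Ioo 0 T := fun t ht => ⟨by linarith [ht.1], by linarith [ht.2]⟩
  have hmp : MeasurePreserving (fun t : ℝ => t + h) volume volume := measurePreserving_add_right _ h
  have hmp2 : MeasurePreserving (fun z : α × ℝ => (z.1, z.2 + h)) (μ.prod volume) (μ.prod volume) :=
    (MeasurePreserving.id μ).prod hmp
  have hae : ∀ P : ℝ → Prop, (∀ᵐ t ∂(volume.restrict (Ioo 0 T)), P t) →
      ∀ᵐ t ∂(volume.restrict E), P (t + h) := by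
    intro P hP
    rw [ae_restrict_iff' measurableSet_Ioo] at hP
    rw [ae_restrict_iff' measurableSet_Ioo]
    filter_upwards [hmp.quasiMeasurePreserving.ae hP] with t ht hE using ht (hEh t hE)
  have hrep' : ∀ᵐ z ∂(μ.prod (volume.restrict E)),
      u (z.1, z.2 + h) = c z.1 + timePrimitive T w z.1 (z.2 + h) := by
    have h1 : ∀ᵐ z ∂(μ.prod volume), z ∈ (univ : Set α) ×ˢ Ioo 0 T →
        u z = c z.1 + timePrimitive T w z.1 z.2 := by
      rw [← ae_restrict_iff' (MeasurableSet.univ.prod measurableSet_Ioo), ← Measure.prod_restrict,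
        Measure.restrict_univ]
      exact hrep
    have h2 := hmp2.quasiMeasurePreserving.ae h1
    have h3 : μ.prod (volume.restrict E) = (μ.prod volume).restrict (univ ×ˢ E) := by
      rw [← Measure.prod_restrict, Measure.restrict_univ]
    rw [h3, ae_restrict_iff' (MeasurableSet.univ.prod measurableSet_Ioo)]
    filter_upwards [h2] with z hz hzE using hz ⟨mem_univ _, hEh _ hzE.2⟩
  have hdens : Integrable (density (p.cyl T) fun z => u (z.1, z.2 + h))
      (μ.prod (volume.restrict E)) := by
    have h1 := (hmp2.integrable_comp (integrable_timeTrunc_prod u.integrable_density).1).2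
      (integrable_timeTrunc_prod u.integrable_density)
    have h3 : μ.prod (volume.restrict E) = (μ.prod volume).restrict (univ ×ˢ E) := by
      rw [← Measure.prod_restrict, Measure.restrict_univ]
    rw [h3]
    refine h1.integrableOn.congr ?_
    filter_upwards [ae_restrict_mem (MeasurableSet.univ.prod measurableSet_Ioo)] with z hz
    simp only [Function.comp_apply, timeTrunc, indicator_of_mem (hEh z.2 hz.2)]
    rfl
  have hfint : Integrable ((Ioo 0 T).indicator f) :=
    (integrable_indicator_iff measurableSet_Ioo).2 hu2
  have hfE : IntegrableOn (fun t => f (t + h)) E := by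
    refine (hfint.comp_add_right h).integrableOn.congr ?_
    filter_upwards [ae_restrict_mem measurableSet_Ioo] with t ht
    rw [indicator_of_mem (hEh t ht)]
  obtain ⟨hi, hle⟩ := integral_mul_sub_le_of_mem_subdifferential hξ measurableSet_Ioo hET
    (w := fun z => u (z.1, z.2 + h))
    (u.stronglyMeasurable.comp_measurable (measurable_fst.prodMk (measurable_snd.add_const h)))
    hdens (v := fun t => timeEval u (t + h)) (hae _ (ae_coeFn_timeEval u)) (hae _ hu1) hfE
  have hrepE : ∀ᵐ z ∂(μ.prod (volume.restrict E)),
      u z = c z.1 + timePrimitive T w z.1 z.2 := by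
    rw [← prod_restrict_univ_prod hET]
    exact ae_restrict_of_ae hrep
  -- The unknown function `c` cancels in the increment, leaving only the time integral of `w`.
  have hpt : (fun z => ξ z * (u (z.1, z.2 + h) - u z)) =ᵐ[μ.prod (volume.restrict E)]
      fun z => timeTrunc T ξ z.1 z.2 * ∫ τ in z.2..z.2 + h, timeTrunc T w z.1 τ := by
    have hx : ∀ᵐ z ∂(μ.prod (volume.restrict E)), Integrable (timeTrunc T w z.1) :=
      Measure.quasiMeasurePreserving_fst.ae (ae_integrable_timeTrunc w)
    have hz2 : ∀ᵐ z ∂(μ.prod (volume.restrict E)), z.2 ∈ E :=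
      Measure.quasiMeasurePreserving_snd.ae (ae_restrict_mem measurableSet_Ioo)
    filter_upwards [hx, hz2, hrep', hrepE] with z h1 h2 h3 h4
    rw [h3, h4, ← timePrimitive_sub h1, timeTrunc, indicator_of_mem (hET h2)]
    ring
  have hi' := hi.congr hpt
  rw [integral_congr_ae hpt, integral_prod _ hi'] at hle
  simp_rw [intervalIntegral.integral_of_le hab, integral_Ioc_eq_integral_Ioo]
  refine hle.trans (le_of_eq ?_)
  rw [← integral_sub hfE (hu2.mono_set hET)]
  refine setIntegral_congr_fun measurableSet_Ioo fun t ht => ?_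
  simp only [indicator_of_mem (hEh t ht), indicator_of_mem (hET ht), hf]

/-- Convergence of Steklov averages inside the duality pairing. -/
theorem tendsto_integral_average (ξ : LpVar (p.cyl T).conj) (w : LpVar (p.cyl T)) {h : ℕ → ℝ}
    (h0 : ∀ n, h n ≠ 0) (hlim : Tendsto h atTop (𝓝 0)) {a b : ℝ} (hab : a ≤ b) :
    Tendsto (fun n => ∫ x, (∫ t in a..b, timeTrunc T ξ x t *
        ((h n)⁻¹ * ∫ τ in t..t + h n, timeTrunc T w x τ)) ∂μ) atTop
      (𝓝 (∫ x, (∫ t in a..b, timeTrunc T ξ x t * timeTrunc T w x t) ∂μ)) := by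
  have hA := integrable_timeTrunc_prod ξ.integrable_density
  have hB := integrable_timeTrunc_prod w.integrable_density
  have hAx := ae_integrable_timeTrunc_density (p := p.conj) ξ
  have hBx := ae_integrable_timeTrunc_density w
  have hA0 : ∀ x t, 0 ≤ timeTrunc T (density (p.cyl T).conj ξ) x t := fun x t =>
    indicator_nonneg (fun _ _ => density_nonneg _ _ _) _
  have hB0 : ∀ x t, 0 ≤ timeTrunc T (density (p.cyl T) w) x t := fun x t =>
    indicator_nonneg (fun _ _ => density_nonneg _ _ _) _
  have hwx := ae_integrable_timeTrunc w
  refine tendsto_integral_of_dominated_convergence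
    (fun x => (∫ t, timeTrunc T (density (p.cyl T).conj ξ) x t) +
      ∫ t, timeTrunc T (density (p.cyl T) w) x t) ?_
    (hA.integral_prod_left.add hB.integral_prod_left) ?_ ?_
  · intro n
    simp_rw [intervalIntegral.integral_of_le hab]
    -- Joint measurability is read off from differences of `timePrimitive`; for almost every `x`
    -- these are the interval integrals.
    have hm : AEStronglyMeasurable (fun z : α × ℝ => timeTrunc T ξ z.1 z.2 *
        ((h n)⁻¹ * (timePrimitive T w z.1 (z.2 + h n) - timePrimitive T w z.1 z.2)))
        (μ.prod (volume.restrict (Ioc a b))) := by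
      have hI := stronglyMeasurable_timePrimitive T w.stronglyMeasurable
      exact ((stronglyMeasurable_timeTrunc T ξ.stronglyMeasurable).mul
        (((hI.comp_measurable (measurable_fst.prodMk (measurable_snd.add_const (h n)))).sub
          hI).const_mul _)).aestronglyMeasurable
    refine hm.integral_prod_right'.congr ?_
    filter_upwards [hwx] with x hx
    simp_rw [timePrimitive_sub hx]
  · intro n
    filter_upwards [hAx, hBx, hwx, ae_abs_timeTrunc_mul_le T ξ w] with x h1 h2 h3 h4
    exact abs_integral_mul_average_le h3 h1 h2 (hA0 x) (hB0 x) h4 hab (h0 n)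
  · filter_upwards [hAx, hBx, hwx, ae_abs_timeTrunc_mul_le T ξ w] with x h1 h2 h3 h4
    exact tendsto_integral_mul_average h3
      ((stronglyMeasurable_timeTrunc T ξ.stronglyMeasurable).comp_measurable
        measurable_prodMk_left).aestronglyMeasurable h1 h2 h4 h0 hlim hab

end Subgradient

/-! ### The integrated chain rule at Lebesgue points, and the test with a frozen state. -/

section ChainRule

variable {α : Type*} [MeasurableSpace α] {μ : Measure α} [SFinite μ] {p : Exponent μ} {T : ℝ}

/-- The density in time of the duality pairing on the cylinder. -/
noncomputable def pairingDensity (ξ : LpVar (p.cyl T).conj) (w : LpVar (p.cyl T)) (t : ℝ) : ℝ :=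
  ∫ x, timeTrunc T ξ x t * timeTrunc T w x t ∂μ

theorem integrable_timeTrunc_mul (ξ : LpVar (p.cyl T).conj) (w : LpVar (p.cyl T)) :
    Integrable (fun z : α × ℝ => timeTrunc T ξ z.1 z.2 * timeTrunc T w z.1 z.2)
      (μ.prod volume) := by
  refine (integrable_timeTrunc_prod (integrable_pairing ξ w)).congr
    (Eventually.of_forall fun z => ?_)
  by_cases hz : z.2 ∈ Ioo 0 T <;> simp [timeTrunc, hz]

theorem integrable_pairingDensity (ξ : LpVar (p.cyl T).conj) (w : LpVar (p.cyl T)) :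
    Integrable (pairingDensity ξ w) :=
  (integrable_timeTrunc_mul ξ w).integral_prod_right

theorem integral_integral_timeTrunc_mul (ξ : LpVar (p.cyl T).conj) (w : LpVar (p.cyl T)) {a b : ℝ}
    (hab : a ≤ b) : ∫ x, (∫ t in a..b, timeTrunc T ξ x t * timeTrunc T w x t) ∂μ =
      ∫ t in a..b, pairingDensity ξ w t := by
  simp_rw [intervalIntegral.integral_of_le hab]
  exact integral_integral_swap ((integrable_timeTrunc_mul ξ w).mono_measure
    (Measure.prod_mono le_rfl Measure.restrict_le_self))

theorem integral_pairingDensity (ξ : LpVar (p.cyl T).conj) (w : LpVar (p.cyl T)) {a b : ℝ}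
    (hab : a ≤ b) (ha : 0 ≤ a) (hb : b ≤ T) :
    ∫ t in a..b, pairingDensity ξ w t = ∫ z, ξ z * w z ∂(μ.prod (volume.restrict (Ioo a b))) := by
  have hi := (integrable_timeTrunc_mul ξ w).mono_measure
    (Measure.prod_mono (μ := μ) le_rfl (Measure.restrict_le_self (s := Ioo a b)))
  rw [intervalIntegral.integral_of_le hab, integral_Ioc_eq_integral_Ioo]
  refine (integral_prod_symm _ hi).symm.trans (integral_congr_ae ?_)
  have hz2 : ∀ᵐ z ∂(μ.prod (volume.restrict (Ioo a b))), z.2 ∈ Ioo a b :=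
    Measure.quasiMeasurePreserving_snd.ae (ae_restrict_mem measurableSet_Ioo)
  filter_upwards [hz2] with z hz
  have : z.2 ∈ Ioo 0 T := Ioo_subset_Ioo ha hb hz
  simp only [timeTrunc, indicator_of_mem this]

theorem tendsto_average_of_hasDerivAt {f : ℝ → ℝ} (hf : Integrable f) {t y : ℝ}
    (ht : HasDerivAt (fun t => ∫ τ in Iic t, f τ) y t) {h : ℕ → ℝ}
    (h0 : ∀ n, h n ≠ 0) (hlim : Tendsto h atTop (𝓝 0)) :
    Tendsto (fun n => (h n)⁻¹ * ∫ τ in t..t + h n, f τ) atTop (𝓝 y) := by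
  have h2 := ht.tendsto_slope_zero.comp
    (tendsto_nhdsWithin_iff.2 ⟨hlim, Eventually.of_forall h0⟩)
  simpa [Function.comp_def,
    intervalIntegral.integral_Iic_sub_Iic hf.integrableOn hf.integrableOn] using h2

/-- The integrated chain rule between Lebesgue points. -/
theorem sub_eq_integral_of_hasDerivAt {φ : LpVar p → EReal}
    {u w : LpVar (p.cyl T)} {c : α → ℝ}
    (hrep : ∀ᵐ z ∂(μ.prod (volume.restrict (Ioo 0 T))), u z = c z.1 + timePrimitive T w z.1 z.2)
    {ξ : LpVar (p.cyl T).conj} (hξ : ξ ∈ subdifferential (Phi φ) u) {f : ℝ → ℝ}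
    (hf : f = (Ioo 0 T).indicator fun t => (φ (timeEval u t)).toReal) {a b : ℝ} (hab : a ≤ b)
    (ha : 0 < a) (hb : b < T) (hda : HasDerivAt (fun t => ∫ τ in Iic t, f τ) (f a) a)
    (hdb : HasDerivAt (fun t => ∫ τ in Iic t, f τ) (f b) b) :
    f b - f a = ∫ t in a..b, pairingDensity ξ w t := by
  have hfi : Integrable f := by
    rw [hf]
    exact (integrable_indicator_iff measurableSet_Ioo).2
      (finite_and_integrable_of_Phi_lt_top hξ.1).2
  -- The factor `h` is kept on both sides so that one statement serves both signs of the shift.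
  have key : ∀ h : ℝ, h ≠ 0 → 0 ≤ a + h → b + h ≤ T →
      h * ∫ x, (∫ t in a..b, timeTrunc T ξ x t * (h⁻¹ * ∫ τ in t..t + h, timeTrunc T w x τ)) ∂μ ≤
      h * ((h⁻¹ * ∫ τ in b..b + h, f τ) - h⁻¹ * ∫ τ in a..a + h, f τ) := by
    intro h hh h1 h2
    have h3 := integral_translation_le hrep hξ hab ha.le hb.le h1 h2
    rw [← hf, integral_comp_add_sub hfi.intervalIntegrable hfi.intervalIntegrable
      hfi.intervalIntegrable] at h3
    rw [← mul_sub, mul_inv_cancel_left₀ hh, ← integral_const_mul]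
    refine le_trans (le_of_eq ?_) h3
    congr 1
    ext x
    rw [← intervalIntegral.integral_const_mul]
    congr 1
    ext t
    field_simp
  -- Shifts up to `δ` in either direction keep `(a, b)` inside `(0, T)`.
  set δ : ℝ := min a (T - b) with hδ
  have hδ0 : 0 < δ := lt_min ha (by linarith)
  set h : ℕ → ℝ := fun n => δ / (n + 1) with hh
  have hpos : ∀ n, 0 < h n := fun n => by positivity
  have hle : ∀ n, h n ≤ δ := fun n => div_le_self hδ0.le (by linarith [n.cast_nonneg (α := ℝ)])
  have hδa : δ ≤ a := min_le_left _ _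
  have hδb : δ ≤ T - b := min_le_right _ _
  have hlim : Tendsto h atTop (𝓝 0) := by
    have := (tendsto_one_div_add_atTop_nhds_zero_nat (𝕜 := ℝ)).const_mul δ
    simpa [hh, div_eq_mul_inv] using this
  rw [← integral_integral_timeTrunc_mul ξ w hab]
  refine le_antisymm ?_ ?_
  -- Backward shifts reverse the inequality on division by `h` and give the upper bound; forward
  -- shifts give the lower one.
  · have hne : ∀ n, -h n ≠ 0 := fun n => neg_ne_zero.2 (hpos n).ne'
    have hlim' : Tendsto (fun n => -h n) atTop (𝓝 0) := by simpa using hlim.neg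
    refine le_of_tendsto_of_tendsto' ((tendsto_average_of_hasDerivAt hfi hdb hne hlim').sub
      (tendsto_average_of_hasDerivAt hfi hda hne hlim'))
      (tendsto_integral_average ξ w hne hlim' hab) fun n => ?_
    have := key (-h n) (hne n) (by linarith [hle n]) (by linarith [hpos n])
    exact (mul_le_mul_left_of_neg (neg_neg_of_pos (hpos n))).1 this
  · refine le_of_tendsto_of_tendsto' (tendsto_integral_average ξ w (fun n => (hpos n).ne') hlim hab)
      ((tendsto_average_of_hasDerivAt hfi hdb (fun n => (hpos n).ne') hlim).sub
      (tendsto_average_of_hasDerivAt hfi hda (fun n => (hpos n).ne') hlim)) fun n => ?_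
    have := key (h n) (hpos n).ne' (by linarith [hpos n]) (by linarith [hle n])
    exact (mul_le_mul_iff_right₀ (hpos n)).1 this

/-- The subgradient inequality tested with a fixed state on a short time interval. -/
theorem integral_sub_le_of_Icc {φ : LpVar p → EReal}
    {u w : LpVar (p.cyl T)} {c : α → ℝ}
    (hrep : ∀ᵐ z ∂(μ.prod (volume.restrict (Ioo 0 T))), u z = c z.1 + timePrimitive T w z.1 z.2)
    {ξ : LpVar (p.cyl T).conj} (hξ : ξ ∈ subdifferential (Phi φ) u) {a b t : ℝ}
    (ha : 0 ≤ a) (hb : b ≤ T) (ht : t ∈ Icc a b) {v : LpVar p}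
    (hv : (v : α → ℝ) =ᵐ[μ] fun x => c x + timePrimitive T w x t) (hφv : φ v < ⊤) :
    (∫ s in a..b, (φ (timeEval u s)).toReal) - (b - a) * (φ v).toReal ≤
      (b - a) * ∫ s in a..b, ((∫ x, timeTrunc T (density (p.cyl T).conj ξ) x s ∂μ) +
        ∫ x, timeTrunc T (density (p.cyl T) w) x s ∂μ) := by
  have hab : a ≤ b := ht.1.trans ht.2
  set E : Set ℝ := Ioo a b with hEdef
  have hET : E ⊆ Ioo 0 T := Ioo_subset_Ioo ha hb
  have hdens : Integrable (density (p.cyl T) fun z => v z.1) (μ.prod (volume.restrict E)) :=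
    v.integrable_density.comp_fst _
  obtain ⟨hi, hle⟩ := integral_mul_sub_le_of_mem_subdifferential hξ measurableSet_Ioo hET
    (w := fun z => v z.1) (v.stronglyMeasurable.comp_measurable measurable_fst) hdens
    (v := fun _ => v) (Eventually.of_forall fun _ => EventuallyEq.rfl)
    (Eventually.of_forall fun _ => hφv) (integrableOn_const (by simp))
  set A : α × ℝ → ℝ := fun z => timeTrunc T (density (p.cyl T).conj ξ) z.1 z.2 with hA
  set B : α × ℝ → ℝ := fun z => timeTrunc T (density (p.cyl T) w) z.1 z.2 with hB
  have hAi : Integrable A (μ.prod volume) := integrable_timeTrunc_prod ξ.integrable_density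
  have hBi : Integrable B (μ.prod volume) := integrable_timeTrunc_prod w.integrable_density
  have hmono : μ.prod (volume.restrict E) ≤ μ.prod volume :=
    Measure.prod_mono le_rfl Measure.restrict_le_self
  have hAE := hAi.mono_measure hmono
  have hBE := hBi.mono_measure hmono
  have hBx : Integrable (fun x => ∫ τ in E, B (x, τ)) μ := hBE.integral_prod_left
  -- The difference `v - u(·, s)` is the integral of `w` from `s` to `t`. The separated Young bound,
  -- integrated over `τ` and then `s`, produces the factor `b - a`, so dividing by the length of the
  -- interval still leaves a quantity that vanishes as it shrinks.
  have hbound : ‖∫ z, ξ z * (v z.1 - u z) ∂(μ.prod (volume.restrict E))‖ ≤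
      ∫ z, ((b - a) * A z + ∫ τ in E, B (z.1, τ)) ∂(μ.prod (volume.restrict E)) := by
    refine norm_integral_le_of_norm_le ((hAE.const_mul _).add (hBx.comp_fst _)) ?_
    have hfst : ∀ P : α → Prop, (∀ᵐ x ∂μ, P x) → ∀ᵐ z ∂(μ.prod (volume.restrict E)), P z.1 :=
      fun P hP => Measure.quasiMeasurePreserving_fst.ae hP
    have hz2 : ∀ᵐ z ∂(μ.prod (volume.restrict E)), z.2 ∈ E :=
      Measure.quasiMeasurePreserving_snd.ae (ae_restrict_mem measurableSet_Ioo)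
    have hrepE : ∀ᵐ z ∂(μ.prod (volume.restrict E)), u z = c z.1 + timePrimitive T w z.1 z.2 := by
      rw [← prod_restrict_univ_prod hET]
      exact ae_restrict_of_ae hrep
    filter_upwards [hz2, hrepE, hfst _ hv, hfst _ (ae_integrable_timeTrunc w),
      hfst _ (ae_integrable_timeTrunc_density w), hfst _ (ae_abs_timeTrunc_mul_le T ξ w)]
      with z h1 h2 h3 h4 h5 h6
    have e1 : ξ z * (v z.1 - u z) = ∫ τ in z.2..t, timeTrunc T ξ z.1 z.2 * timeTrunc T w z.1 τ := by
      rw [h2, h3, intervalIntegral.integral_const_mul, ← timePrimitive_sub h4]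
      have : timeTrunc T ξ z.1 z.2 = ξ z := by
        rw [timeTrunc, indicator_of_mem (hET h1)]
      rw [this]
      ring
    have hBz : Integrable fun τ => B (z.1, τ) := h5
    have hconst : IntegrableOn (fun _ : ℝ => A z) (Ioc a b) := integrableOn_const (by simp)
    rw [e1, intervalIntegral.norm_integral_eq_norm_integral_uIoc]
    have hsub : uIoc z.2 t ⊆ Ioc a b := by
      intro τ hτ
      rcases mem_uIoc.1 hτ with h | h
      · exact ⟨h1.1.trans h.1, h.2.trans ht.2⟩
      · exact ⟨ht.1.trans_lt h.1, h.2.trans h1.2.le⟩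
    have hnn : ∀ τ, 0 ≤ A z + B (z.1, τ) := fun τ => (abs_nonneg _).trans (h6 z.2 τ)
    have e2 : ‖∫ τ in uIoc z.2 t, timeTrunc T ξ z.1 z.2 * timeTrunc T w z.1 τ‖ ≤
        ∫ τ in uIoc z.2 t, (A z + B (z.1, τ)) :=
      norm_integral_le_of_norm_le ((hconst.mono_set hsub).add hBz.integrableOn)
        (Eventually.of_forall fun τ => h6 z.2 τ)
    refine e2.trans ((setIntegral_mono_set (hconst.add hBz.integrableOn)
      (Eventually.of_forall hnn) hsub.eventuallyLE).trans (le_of_eq ?_))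
    refine (integral_add hconst hBz.integrableOn).trans ?_
    rw [integral_Ioc_eq_integral_Ioo (f := fun τ => B (z.1, τ))]
    simp [hab, hEdef]
  have hval : ∫ z, ((b - a) * A z + ∫ τ in E, B (z.1, τ)) ∂(μ.prod (volume.restrict E)) =
      (b - a) * ∫ s in a..b, ((∫ x, A (x, s) ∂μ) + ∫ x, B (x, s) ∂μ) := by
    have hfst := integral_fun_fst (μ := μ) (ν := volume.restrict E) fun x => ∫ τ in E, B (x, τ)
    rw [integral_add (hAE.const_mul _) (hBx.comp_fst _), integral_const_mul,
      integral_prod_symm _ hAE, hfst, ← integral_prod _ hBE, integral_prod_symm _ hBE,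
      intervalIntegral.integral_of_le hab, integral_Ioc_eq_integral_Ioo,
      integral_add hAi.integral_prod_right.integrableOn hBi.integral_prod_right.integrableOn]
    simp [hEdef, hab]
    ring
  rw [intervalIntegral.integral_of_le hab (f := fun s => (φ (timeEval u s)).toReal),
    integral_Ioc_eq_integral_Ioo]
  have hcst : ∫ _ in E, (φ v).toReal = (b - a) * (φ v).toReal := by
    simp [hEdef, hab]
  rw [hcst] at hle
  rw [hval] at hbound
  have := neg_le_of_abs_le hbound
  linarith

end ChainRule

/-! ### Identifying the functional along the curve at every time. -/

section Representative

variable {α : Type*} [MeasurableSpace α] {μ : Measure α} [SFinite μ] {p : Exponent μ} {T : ℝ}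

/-- A set of full measure is dense because nonempty open sets have positive measure; taking closures
reaches the endpoints. -/
theorem mem_closure_of_ae_mem {T : ℝ} (hT : 0 < T) {G : Set ℝ}
    (hG : ∀ᵐ t ∂(volume.restrict (Ioo 0 T)), t ∈ G) {t : ℝ} (ht : t ∈ Icc 0 T) : t ∈ closure G := by
  have h1 : Ioo 0 T ⊆ closure G := by
    intro s hs
    rw [mem_closure_iff]
    intro O hO hsO
    by_contra hcon
    have h2 : O ∩ Ioo 0 T ⊆ {t | t ∈ Ioo 0 T ∧ t ∉ G} := fun τ hτ =>
      ⟨hτ.2, fun h => hcon ⟨τ, hτ.1, h⟩⟩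
    have h3 : volume {t | t ∈ Ioo 0 T ∧ t ∉ G} = 0 := by
      rw [ae_restrict_iff' measurableSet_Ioo] at hG
      have := ae_iff.1 hG
      simpa only [Classical.not_imp] using this
    have h4 := (hO.inter isOpen_Ioo).measure_pos volume ⟨s, hsO, hs⟩
    exact h4.ne' (measure_mono_null h2 h3)
  have h2 := closure_minimal h1 isClosed_closure
  rw [closure_Ioo hT.ne] at h2
  exact h2 ht

/-- A lower semicontinuous functional is bounded along a curve by the continuous function with
which it agrees on a dense set of times. -/
theorem le_of_eq_on_dense {V : Type*} [TopologicalSpace V] {φ : V → EReal}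
    (hφ : LowerSemicontinuous φ) {U : ℝ → V} {F : ℝ → ℝ} {S G : Set ℝ} (hGS : G ⊆ S) {t : ℝ}
    (hU : ContinuousWithinAt U S t) (hF : ContinuousWithinAt F S t) (ht : t ∈ closure G)
    (hG : ∀ s ∈ G, φ (U s) = F s) : φ (U t) ≤ F t := by
  by_contra hcon
  obtain ⟨y, hy1, hy2⟩ := EReal.lt_iff_exists_real_btwn.1 (not_le.1 hcon)
  have h1 : ∀ᶠ s in 𝓝[G] t, (y : EReal) < φ (U s) :=
    (hU.mono hGS).eventually (hφ (U t) y hy2)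
  have h2 : ∀ᶠ s in 𝓝[G] t, F s < y :=
    (hF.mono hGS).eventually (gt_mem_nhds (EReal.coe_lt_coe_iff.1 hy1))
  have := mem_closure_iff_nhdsWithin_neBot.1 ht
  obtain ⟨s, ⟨h3, h4⟩, h5⟩ := ((h1.and h2).and self_mem_nhdsWithin).exists
  rw [hG s h5, EReal.coe_lt_coe_iff] at h3
  exact lt_asymm h3 h4

/-- The chain rule between good times yields a continuous `F` equal to `φ ∘ U` on a dense set.
Semicontinuity controls `φ ∘ U` only from above, so a second use of the subgradient inequality
excludes downward jumps at the remaining times. -/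
theorem exists_representative_and_chain_rule (hT : 0 < T) {φ : LpVar p → EReal}
    (hφ : IsProperLscConvex φ) {u w : LpVar (p.cyl T)} {c : α → ℝ}
    (hrep : ∀ᵐ z ∂(μ.prod (volume.restrict (Ioo 0 T))), u z = c z.1 + timePrimitive T w z.1 z.2)
    {ξ : LpVar (p.cyl T).conj} (hξ : ξ ∈ subdifferential (Phi φ) u) :
    ∃ U : ℝ → LpVar p, AbsolutelyContinuousOnInterval U 0 T ∧
      (∀ᵐ t ∂(volume.restrict (Ioo 0 T)), U t = timeEval u t) ∧
      (∀ t ∈ Icc 0 T, φ (U t) < ⊤) ∧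
      ∀ s ∈ Icc 0 T, ∀ t ∈ Icc 0 T, (φ (U t)).toReal - (φ (U s)).toReal =
        ∫ τ in s..t, pairingDensity ξ w τ := by
  obtain ⟨U, hUrep, hUac, hUev⟩ := exists_absolutelyContinuous_representative hT u w hrep
  obtain ⟨hu1, hu2⟩ := finite_and_integrable_of_Phi_lt_top hξ.1
  set f : ℝ → ℝ := (Ioo 0 T).indicator fun t => (φ (timeEval u t)).toReal with hf
  have hfi : Integrable f := (integrable_indicator_iff measurableSet_Ioo).2 hu2
  have hri := integrable_pairingDensity ξ w
  have hrI : ∀ a b, IntervalIntegrable (pairingDensity ξ w) volume a b := fun a b =>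
    hri.intervalIntegrable
  set G : Set ℝ := {t | t ∈ Ioo 0 T ∧ U t = timeEval u t ∧ φ (timeEval u t) < ⊤ ∧
    HasDerivAt (fun t => ∫ τ in Iic t, f τ) (f t) t} with hG
  have hGae : ∀ᵐ t ∂(volume.restrict (Ioo 0 T)), t ∈ G := by
    filter_upwards [ae_restrict_mem measurableSet_Ioo, hUev, hu1,
      ae_restrict_of_ae (hasDerivAt_integral_Iic_ae hfi)] with t h1 h2 h3 h4 using ⟨h1, h2, h3, h4⟩
  obtain ⟨t₀, ht₀⟩ : G.Nonempty := by
    rw [← closure_nonempty_iff]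
    exact ⟨0, mem_closure_of_ae_mem hT hGae ⟨le_rfl, hT.le⟩⟩
  set F : ℝ → ℝ := fun t => f t₀ + ∫ τ in t₀..t, pairingDensity ξ w τ with hF
  have hFc : Continuous F :=
    continuous_const.add (intervalIntegral.continuous_primitive hrI t₀)
  have hfF : ∀ t ∈ G, f t = F t := by
    intro t ht
    rcases le_total t₀ t with h | h
    · have := sub_eq_integral_of_hasDerivAt hrep hξ hf h ht₀.1.1 ht.1.2 ht₀.2.2.2 ht.2.2.2
      rw [hF]
      simp only
      linarith
    · have := sub_eq_integral_of_hasDerivAt hrep hξ hf h ht.1.1 ht₀.1.2 ht.2.2.2 ht₀.2.2.2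
      rw [hF]
      simp only
      rw [intervalIntegral.integral_symm]
      linarith
  have hφG : ∀ t ∈ G, φ (U t) = F t := by
    intro t ht
    rw [← hfF t ht, hf, indicator_of_mem ht.1, ht.2.1,
      EReal.coe_toReal ht.2.2.1.ne (hφ.ne_bot _)]
  have hUc : ContinuousOn U (Icc 0 T) := by
    have := hUac.continuousOn
    rwa [uIcc_of_le hT.le] at this
  have hle : ∀ t ∈ Icc 0 T, φ (U t) ≤ F t := fun t ht =>
    le_of_eq_on_dense hφ.lsc (S := Icc 0 T) (G := G) (fun s hs => Ioo_subset_Icc_self hs.1)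
      (hUc t ht) hFc.continuousWithinAt (mem_closure_of_ae_mem hT hGae ht) hφG
  have hfin : ∀ t ∈ Icc 0 T, φ (U t) < ⊤ := fun t ht => (hle t ht).trans_lt (EReal.coe_lt_top _)
  have hval : ∀ t ∈ Icc 0 T, (φ (U t)).toReal = F t := by
    intro t ht
    refine le_antisymm ?_ ?_
    · have := EReal.toReal_le_toReal (hle t ht) (hφ.ne_bot _) (EReal.coe_ne_top _)
      rwa [EReal.toReal_coe] at this
    refine le_of_forall_pos_le_add fun ε hε => ?_
    set κ : ℝ → ℝ := fun s => (∫ x, timeTrunc T (density (p.cyl T).conj ξ) x s ∂μ) +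
      ∫ x, timeTrunc T (density (p.cyl T) w) x s ∂μ with hκ
    have hκi : Integrable κ :=
      (integrable_timeTrunc_prod ξ.integrable_density).integral_prod_right.add
        (integrable_timeTrunc_prod w.integrable_density).integral_prod_right
    have hκc : Continuous fun s => ∫ τ in t..s, κ τ :=
      intervalIntegral.continuous_primitive (fun _ _ => hκi.intervalIntegrable) t
    -- Half of `ε` pays for the oscillation of `F`; the other half is split in two because the
    -- integral of `κ` over `[a, b]` is a difference of two integrals based at `t`.
    obtain ⟨δ₁, hδ₁, h₁⟩ := Metric.continuousAt_iff.1 hFc.continuousAt (ε / 2) (by positivity)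
    obtain ⟨δ₂, hδ₂, h₂⟩ := Metric.continuousAt_iff.1 (hκc.continuousAt (x := t)) (ε / 4)
      (by positivity)
    simp only [Real.dist_eq, intervalIntegral.integral_same, sub_zero] at h₁ h₂
    -- A one-sided interval suffices: to the right of `t` if `t < T`, and to the left at `t = T`.
    -- This includes the endpoints of `[0, T]`.
    obtain ⟨a, b, ha, hb, hab, hat, htb, hlen⟩ : ∃ a b : ℝ, 0 ≤ a ∧ b ≤ T ∧ a < b ∧ a ≤ t ∧ t ≤ b ∧
        b - a < min δ₁ δ₂ := by
      have hδ : 0 < min δ₁ δ₂ := lt_min hδ₁ hδ₂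
      rcases lt_or_ge t T with h | h
      · refine ⟨t, min T (t + min δ₁ δ₂ / 2), ht.1, min_le_left _ _, lt_min h (by linarith), le_rfl,
          le_min h.le (by linarith), ?_⟩
        have := min_le_right T (t + min δ₁ δ₂ / 2)
        linarith
      · refine ⟨max 0 (T - min δ₁ δ₂ / 2), T, le_max_left _ _, le_rfl,
          max_lt hT (by linarith), max_le ht.1 (by linarith), ht.2, ?_⟩
        have := le_max_right 0 (T - min δ₁ δ₂ / 2)
        linarith
    have hl1 : b - a < δ₁ := hlen.trans_le (min_le_left _ _)
    have hl2 : b - a < δ₂ := hlen.trans_le (min_le_right _ _)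
    have hmain := integral_sub_le_of_Icc hrep hξ ha hb ⟨hat, htb⟩ (hUrep t) (hfin t ht)
    have hFint : ∫ s in a..b, (φ (timeEval u s)).toReal = ∫ s in a..b, F s := by
      rw [intervalIntegral.integral_of_le hab.le, intervalIntegral.integral_of_le hab.le,
        integral_Ioc_eq_integral_Ioo, integral_Ioc_eq_integral_Ioo]
      refine integral_congr_ae ?_
      have hsub : Ioo a b ⊆ Ioo 0 T := Ioo_subset_Ioo ha hb
      filter_upwards [ae_mono (Measure.restrict_mono hsub le_rfl) hGae] with s hs
      rw [← hfF s hs, hf, indicator_of_mem hs.1]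
    have hFlow : (b - a) * (F t - ε / 2) ≤ ∫ s in a..b, F s := by
      have h3 := intervalIntegral.integral_mono_on (μ := volume) hab.le
        (intervalIntegrable_const (c := F t - ε / 2)) (hFc.intervalIntegrable a b)
        (fun s hs => by
          have h4 : |s - t| < δ₁ := by
            rw [abs_lt]
            constructor <;> linarith [hs.1, hs.2]
          linarith [(abs_lt.1 (h₁ h4)).1])
      rwa [intervalIntegral.integral_const, smul_eq_mul] at h3
    have hκs : ∫ s in a..b, κ s ≤ ε / 2 := by
      have ea : |∫ τ in t..a, κ τ| < ε / 4 := h₂ (by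
        rw [abs_lt]
        constructor <;> linarith)
      have eb : |∫ τ in t..b, κ τ| < ε / 4 := h₂ (by
        rw [abs_lt]
        constructor <;> linarith)
      have e := intervalIntegral.integral_interval_sub_left (hκi.intervalIntegrable (a := t) (b := b))
        (hκi.intervalIntegrable (a := t) (b := a))
      linarith [(abs_lt.1 ea).1, (abs_lt.1 eb).2]
    rw [hFint] at hmain
    have hba : 0 < b - a := by linarith
    have h5 : (b - a) * (F t - ε / 2) - (b - a) * (φ (U t)).toReal ≤ (b - a) * (ε / 2) := by
      have := mul_le_mul_of_nonneg_left hκs hba.le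
      linarith
    rw [← mul_sub] at h5
    have h6 := le_of_mul_le_mul_left h5 hba
    linarith
  refine ⟨U, hUac, hUev, hfin, fun s hs t ht => ?_⟩
  rw [hval s hs, hval t ht, hF]
  simp only
  rw [add_sub_add_left_eq_sub, intervalIntegral.integral_interval_sub_left (hrI _ _) (hrI _ _)]

end Representative

/-! ### Local integrability on the Euclidean cylinder. -/

section Domain

variable {N : ℕ} {Ω : Set (EuclideanSpace ℝ (Fin N))} {T : ℝ}

/-- The majorant `1 + |w|^p` is integrable because `K ×ˢ Ioo 0 T` has finite measure, whereas `Ω`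
may have infinite measure. -/
theorem integrableOn_compact_prod {p : Exponent (volume.restrict Ω)} (w : LpVar (p.cyl T))
    (K : Set (EuclideanSpace ℝ (Fin N))) (hK : IsCompact K) (hKΩ : K ⊆ Ω) :
    IntegrableOn w (K ×ˢ Ioo 0 T) := by
  have hm : (volume : Measure (EuclideanSpace ℝ (Fin N) × ℝ)).restrict (K ×ˢ Ioo 0 T) =
      (volume.restrict K).prod (volume.restrict (Ioo 0 T)) := by
    rw [Measure.volume_eq_prod, Measure.prod_restrict]
  have hle : (volume.restrict K).prod (volume.restrict (Ioo 0 T)) ≤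
      (volume.restrict Ω).prod (volume.restrict (Ioo 0 T)) :=
    Measure.prod_mono (Measure.restrict_mono hKΩ le_rfl) le_rfl
  have hfin : IsFiniteMeasure ((volume : Measure (EuclideanSpace ℝ (Fin N))).restrict K) :=
    ⟨by simpa using hK.measure_lt_top⟩
  rw [IntegrableOn, hm]
  refine ((integrable_const (1 : ℝ)).add (w.integrable_density.mono_measure hle)).mono'
    w.stronglyMeasurable.aestronglyMeasurable ?_
  filter_upwards [ae_mono hle (p.cyl T).ae_one_le_toReal] with z hz
  exact abs_le_one_add_rpow _ hz

end Domain

end VarLebesgue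
-- The chain rule on the cylinder over an open set.
open VarLebesgue in
theorem proposition4p1 {N : ℕ} (Ω : Set (EuclideanSpace ℝ (Fin N))) (hΩ : IsOpen Ω)
    (T : ℝ) (hT : 0 < T)
    (p : Exponent (volume.restrict Ω))
    (φ : LpVar p → EReal) (hφ : IsProperLscConvex φ)
    (u ut : LpVar (p.cyl T)) (hut : IsWeakTimeDeriv Ω T u ut)
    (ξ : LpVar (p.cyl T).conj) (hξ : ξ ∈ subdifferential (Phi φ) u) :
    ∃ U : ℝ → LpVar p,
      -- `U` is the absolutely continuous representative of `Pu` on `[0, T]`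
      AbsolutelyContinuousOnInterval U 0 T ∧
      (∀ᵐ t ∂(volume.restrict (Ioo 0 T)), U t = timeEval u t) ∧
      -- `t ↦ φ(Pu(t))` is finite and absolutely continuous on `[0, T]`
      (∀ t ∈ Icc 0 T, φ (U t) < ⊤) ∧
      AbsolutelyContinuousOnInterval (fun t => (φ (U t)).toReal) 0 T ∧
      -- the chain rule at every point of differentiability
      (∀ t ∈ Ioo 0 T, DifferentiableAt ℝ U t →
        DifferentiableAt ℝ (fun s => (φ (U s)).toReal) t →
        ∀ η ∈ subdifferential φ (U t),
          deriv (fun s => (φ (U s)).toReal) t = pairing η (deriv U t)) ∧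
      -- the integrated chain rule
      (∀ s t : ℝ, 0 ≤ s → s < t → t ≤ T →
        (φ (U t)).toReal - (φ (U s)).toReal = ∫ z in Ω ×ˢ Ioo s t, ξ z * ut z) := by
  obtain ⟨c, -, hrep⟩ := exists_ae_eq_add_timePrimitive hΩ hT u.stronglyMeasurable
    ut.stronglyMeasurable (integrableOn_compact_prod u) (integrableOn_compact_prod ut)
    (ae_integrableOn_section u) (ae_integrableOn_section ut) hut
  obtain ⟨U, hU1, hU2, hU3, hU4⟩ := exists_representative_and_chain_rule hT hφ hrep hξ
  refine ⟨U, hU1, hU2, hU3, ?_, ?_, ?_⟩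
  -- The increments of `φ ∘ U` are those of a primitive of the integrable function `pairingDensity ξ
  -- ut`.
  · refine absolutelyContinuousOnInterval_of_dist_le
      (absolutelyContinuousOnInterval_integral_Iic (integrable_pairingDensity ξ ut) 0 T) ?_
    intro s hs t ht
    rw [uIcc_of_le hT.le] at hs ht
    rw [dist_comm, Real.dist_eq, hU4 s hs t ht, dist_comm, Real.dist_eq,
      intervalIntegral.integral_Iic_sub_Iic (integrable_pairingDensity ξ ut).integrableOn
        (integrable_pairingDensity ξ ut).integrableOn]
  · intro t ht hd1 hd2 η hη
    refine deriv_eq_pairing ?_ hd1 hd2 hη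
    filter_upwards [Ioo_mem_nhds ht.1 ht.2] with s hs
    exact ⟨(hU3 s (Ioo_subset_Icc_self hs)).ne, hφ.ne_bot _⟩
  · intro s t hs hst ht
    rw [hU4 s ⟨hs, hst.le.trans ht⟩ t ⟨hs.trans hst.le, ht⟩,
      integral_pairingDensity ξ ut hst.le hs ht, Measure.volume_eq_prod, Measure.prod_restrict]
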